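/- Let $0<L\le\infty$, $I=(-L,L)$ (so $I=\mathbb R$ if $L=\infty$), $H=L^2(I)$ with inner product $(\cdot,\cdot)$, and let $V$ be $H^1_0(I)$ (Dirichlet boundary conditions) or $H^1(I)$ (Neumann boundary conditions), with the norm $\|u\|^2=|u|_H^2+|u_x|_H^2$. Identify $H$ with a subspace of $V^*$ through $\langle h,v\rangle=(h,v)$, and let $\mathcal A:V\to V^*$ be given by $\langle\mathcal Au,v\rangle=(u_x,v_x)$. Let $T>0$, $0<\varepsilon\le1$, let $\varphi(x,t)$ be a measurable real function, $g\in L^2(0,T;H)$, $u_0\in V$, $v_0\in H$, and put $$f(t,\eta)(x)=\varepsilon^{-1}\bigl(\sin\varphi(x,t)-\sin(\varphi(x,t)+\varepsilon\eta(x))\bigr)+g(x,t),\qquad \eta\in H.$$ Let $W(0,T)$ be the space of all $u\in L^2(0,T;V)$ with $u'\in L^2(0,T;H)$ and $u''\in L^2(0,T;V^*)$, the derivatives being distributional with values in $H$ and $V^*$. A weak solution is an $\eta\in W(0,T)$ such that $\eta''+\mathcal A\eta=f(t,\eta)$ in $V^*$ for a.e. $t\in(0,T)$, and $\eta(0)=u_0$,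 $\eta'(0)=v_0$ (in the sense of the representatives $\eta\in C([0,T];H)$ and $\eta'\in C([0,T];V^*)$, which every element of $W(0,T)$ has). Then there is exactly one weak solution $\eta$ (as a class of functions up to equality a.e.). After modification on a null set it satisfies $$\eta\in C([0,T];V),\qquad \eta'\in C([0,T];H),\qquad \eta''\in L^2(0,T;V^*),$$ and $\eta(0)=u_0$ in $V$, $\eta'(0)=v_0$ in $H$. -/

import Mathlib

open MeasureTheory Set
open scoped ContDiff ENNReal

noncomputable section

namespace SineGordon

/-- Test functions on an open set `Ω ⊆ ℝ`: smooth, with compact support contained in `Ω`. -/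
structure IsTestFunction (Ω : Set ℝ) (ψ : ℝ → ℝ) : Prop where
  smooth : ContDiff ℝ ∞ ψ
  compact_support : HasCompactSupport ψ
  support_subset : tsupport ψ ⊆ Ω

/-- `w` is the derivative of `u` in the sense of (`X`-valued) distributions on `Ω`. It is used only
for functions that are locally integrable on `Ω`, so that all integrals converge. -/
def HasWeakDeriv {X : Type*} [NormedAddCommGroup X] [NormedSpace ℝ X]
    (Ω : Set ℝ) (u w : ℝ → X) : Prop :=
  ∀ ψ : ℝ → ℝ, IsTestFunction Ω ψ →
    ∫ x in Ω, deriv ψ x • u x = -∫ x in Ω, ψ x • w x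

/-- The open interval `I = (-L, L)` of `ℝ`; `L = ⊤` gives the whole line. -/
def interval (L : EReal) : Set ℝ := {x : ℝ | -L < (x : EReal) ∧ (x : EReal) < L}

/-- `H = L²(I)`. -/
abbrev H (L : EReal) : Type := Lp ℝ 2 (volume.restrict (interval L))

/-- The Hilbert space `H × H` with `‖(u, w)‖² = |u|² + |w|²`. -/
abbrev HH (L : EReal) : Type := WithLp 2 (H L × H L)

theorem integrable_test_smul {Ω : Set ℝ} {ψ : ℝ → ℝ} (hc : Continuous ψ)
    (hs : HasCompactSupport ψ) (u : Lp ℝ 2 (volume.restrict Ω)) :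
    Integrable (fun x => ψ x • u x) (volume.restrict Ω) :=
  ((Lp.memLp u).locallyIntegrable (by norm_num)).integrable_smul_left_of_hasCompactSupport hc hs

/-- The Sobolev space `H¹(I)`, as the graph of the weak derivative in `L²(I) × L²(I)`: an element is
a pair `(u, u_x)`, with `‖u‖² = |u|² + |u_x|²`. It is the form domain of the Neumann Laplacian. -/
def H1 (L : EReal) : Submodule ℝ (HH L) where
  carrier := {p | HasWeakDeriv (interval L) p.fst p.snd}
  zero_mem' := by
    intro ψ _
    have h : ∀ c : ℝ → ℝ, ∫ x in interval L, c x • (0 : H L) x = 0 := by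
      intro c
      rw [integral_congr_ae (g := fun _ => (0 : ℝ))]
      · simp
      · filter_upwards [Lp.coeFn_zero ℝ 2 (volume.restrict (interval L))] with x hx
        rw [hx]
        simp
    simp only [WithLp.zero_fst, WithLp.zero_snd]
    rw [h, h, neg_zero]
  add_mem' := by
    intro p q hp hq ψ hψ
    have h : ∀ (c : ℝ → ℝ) (_ : Continuous c) (_ : HasCompactSupport c) (u v : H L),
        ∫ x in interval L, c x • (u + v : H L) x
          = (∫ x in interval L, c x • u x) + ∫ x in interval L, c x • v x := by
      intro c hc hs u v
      rw [← integral_add (integrable_test_smul hc hs u) (integrable_test_smul hc hs v)]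
      apply integral_congr_ae
      filter_upwards [Lp.coeFn_add u v] with x hx
      rw [hx, Pi.add_apply, smul_add]
    have hd : Continuous (deriv ψ) := hψ.smooth.continuous_deriv (by simp)
    simp only [WithLp.add_fst, WithLp.add_snd]
    rw [h _ hd hψ.compact_support.deriv, h _ hψ.smooth.continuous hψ.compact_support,
      hp ψ hψ, hq ψ hψ, neg_add]
  smul_mem' := by
    intro a p hp ψ hψ
    have h : ∀ (c : ℝ → ℝ) (u : H L),
        ∫ x in interval L, c x • (a • u : H L) x = a * ∫ x in interval L, c x • u x := by
      intro c u
      rw [← integral_const_mul]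
      apply integral_congr_ae
      filter_upwards [Lp.coeFn_smul a u] with x hx
      simp [hx, mul_left_comm]
    simp only [WithLp.smul_fst, WithLp.smul_snd]
    rw [h, h, hp ψ hψ, mul_neg]

/-- The Sobolev space `H¹₀(I)`: the closure, in the `H¹` norm, of the test functions on `I`
(each identified with the pair `(ψ, ψ')`). It is the form domain of the Dirichlet Laplacian. -/
def H10 (L : EReal) : Submodule ℝ (HH L) :=
  (Submodule.span ℝ {p : HH L | ∃ ψ : ℝ → ℝ, IsTestFunction (interval L) ψ ∧
    p.fst =ᵐ[volume.restrict (interval L)] ψ ∧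
    p.snd =ᵐ[volume.restrict (interval L)] deriv ψ}).topologicalClosure

/-- The embedding `V → H`, `u ↦ u`. -/
def toH {L : EReal} (V : Submodule ℝ (HH L)) : V →L[ℝ] H L :=
  (WithLp.fstL 2 ℝ (H L) (H L)).comp V.subtypeL

/-- The derivative `V → H`, `u ↦ u_x`. -/
def dx {L : EReal} (V : Submodule ℝ (HH L)) : V →L[ℝ] H L :=
  (WithLp.sndL 2 ℝ (H L) (H L)).comp V.subtypeL

/-- The embedding `H → V*`, `⟨h, v⟩ = (h, v)`. -/
def toDual {L : EReal} (V : Submodule ℝ (HH L)) (h : H L) : StrongDual ℝ V :=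
  (innerSL ℝ h).comp (toH V)

/-- The operator `A : V → V*`, `⟨A u, v⟩ = a(u, v) = (u_x, v_x)`. -/
def formOp {L : EReal} (V : Submodule ℝ (HH L)) (u : V) : StrongDual ℝ V :=
  (innerSL ℝ (dx V u)).comp (dx V)

/-- The Lebesgue measure on `(0, T)`. The space `L²(0,T;X)` is `Lp X 2 (timeMeasure T)`. -/
abbrev timeMeasure (T : ℝ) : Measure ℝ := volume.restrict (Ioo 0 T)

/-- `u ∈ W(0,T)` with `u' = u₁` and `u'' = u₂`: here `u ∈ L²(0,T;V)`, `u₁ ∈ L²(0,T;H)` and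
`u₂ ∈ L²(0,T;V*)`, the derivatives being those of distributions with values in `H` and `V*`. -/
structure IsInW {L : EReal} (V : Submodule ℝ (HH L)) (T : ℝ) (u : Lp V 2 (timeMeasure T))
    (u₁ : Lp (H L) 2 (timeMeasure T)) (u₂ : Lp (StrongDual ℝ V) 2 (timeMeasure T)) : Prop where
  deriv_one : HasWeakDeriv (Ioo 0 T) (fun t => toH V (u t)) u₁
  deriv_two : HasWeakDeriv (Ioo 0 T) (fun t => toDual V (u₁ t)) u₂

/-- `u` agrees a.e. on `(0,T)` with a function in `C([0,T];X)` whose value at `0` is `x`. -/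
def HasContinuousRep {X : Type*} [TopologicalSpace X] (T : ℝ) (u : ℝ → X) (x : X) : Prop :=
  ∃ w : ℝ → X, ContinuousOn w (Icc 0 T) ∧ w =ᵐ[timeMeasure T] u ∧ w 0 = x

theorem memLp_sin_sub {L : EReal} (ε : ℝ) {p : ℝ → ℝ} (hp : Measurable p) (h : H L) :
    MemLp (fun x => ε⁻¹ * (Real.sin (p x) - Real.sin (p x + ε * h x))) 2
      (volume.restrict (interval L)) := by
  have hh := (Lp.memLp h).aestronglyMeasurable
  refine (Lp.memLp h).of_le ?_ (ae_of_all _ fun x => ?_)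
  · exact ((Real.continuous_sin.comp_aestronglyMeasurable hp.aestronglyMeasurable).sub
      (Real.continuous_sin.comp_aestronglyMeasurable
        (hp.aestronglyMeasurable.add (hh.const_mul ε)))).const_mul _
  · have h1 : |Real.sin (p x) - Real.sin (p x + ε * h x)| ≤ |ε * h x| := by
      have := Real.abs_sin_sub_sin_le (p x) (p x + ε * h x)
      simpa using this
    rw [Real.norm_eq_abs, Real.norm_eq_abs, abs_mul]
    by_cases he : ε = 0
    · simp [he]
    · calc |ε⁻¹| * |Real.sin (p x) - Real.sin (p x + ε * h x)| ≤ |ε⁻¹| * |ε * h x| := by gcongr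
        _ = |h x| := by
          rw [← abs_mul, ← mul_assoc, inv_mul_cancel₀ he, one_mul]

/-- `f(t,h)(x) = ε⁻¹ (sin φ(x,t) - sin (φ(x,t) + ε h(x))) + g(x,t)`, an element of `H`. -/
def force {L : EReal} (T ε : ℝ) (φ : ℝ → ℝ → ℝ) (hφ : Measurable (Function.uncurry φ))
    (g : Lp (H L) 2 (timeMeasure T)) (t : ℝ) (h : H L) : H L :=
  (memLp_sin_sub ε (hφ.of_uncurry_right (y := t)) h).toLp _ + g t

/-- Weak solutions `η ∈ W(0,T)` of `η'' + A η = f(t,η)`, `η(0) = u₀`, `η'(0) = v₀`. The initial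
values are those of the representatives `η ∈ C([0,T];H)` and `η' ∈ C([0,T];V*)`, which every
element of `W(0,T)` has. -/
def IsWeakSolution {L : EReal} (V : Submodule ℝ (HH L)) (T ε : ℝ) (φ : ℝ → ℝ → ℝ)
    (hφ : Measurable (Function.uncurry φ)) (g : Lp (H L) 2 (timeMeasure T)) (u₀ : V) (v₀ : H L)
    (η : Lp V 2 (timeMeasure T)) : Prop :=
  ∃ (η₁ : Lp (H L) 2 (timeMeasure T)) (η₂ : Lp (StrongDual ℝ V) 2 (timeMeasure T)),
    IsInW V T η η₁ η₂ ∧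
    (∀ᵐ t ∂(timeMeasure T),
      η₂ t + formOp V (η t) = toDual V (force T ε φ hφ g t (toH V (η t)))) ∧
    HasContinuousRep T (fun t => toH V (η t)) (toH V u₀) ∧
    HasContinuousRep T (fun t => toDual V (η₁ t)) (toDual V v₀)

end SineGordon

end

/-!
The equation is a semilinear wave equation whose nonlinearity is Lipschitz from `H` to `H`. Adding
`(η, ·)` to both sides turns it into `η'' + Λ η = F(t, η)`, where `Λ = A + 1 : V → V*` is the Riesz
isomorphism of `V` and `F(t, h) = f(t, h) + h`. The inverse of `Λ` on `H` is the adjoint `ι†` of the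
embedding `ι : V → H`, a bounded operator, so all the analysis can be done with bounded operators:
integrated once in time and multiplied by `Λ⁻¹`, the equation for `(u, v) = (η, η')` reads
`ι u = ι u₀ + ∫ v`, `ι† v = ι† v₀ + ∫ (ι† F - u)`.
In terms of `K(p, q) = (-ι† q, ι p)` on `V × H`, this is `K x = K x₀ + ∫ (x + K b)` with
`b = (0, F)`, the equation `x' = K⁻¹ x + b` multiplied by `K`. The operator `K` is skew-adjoint, and
injective because `ι` is injective with dense range.

*Existence.* The inverse of an injective bounded skew-adjoint operator generates a strongly
continuous group `S` of isometries (`IsSkew.exists_isGroupOfInverse`). With `x(t) = S(t) Y(t)` the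
problem becomes `Y' = S(-t) b(t, S(t) Y)`, whose right-hand side is Lipschitz in `Y` and integrable
in `t`, and Picard iteration applies (`exists_integralEquation_solution`). The solution is
continuous with values in `V × H`, which is the asserted regularity.

*Uniqueness.* The difference of two solutions is only known to be in `L²(0,T;V)`, so that it cannot
be used as a test function. Its primitive in time can (`wave_difference_eq_zero`); the resulting
energy identity loses one derivative, which is harmless since the nonlinearity depends on `η` only
through its norm in `H`. Regularity of every weak solution follows from uniqueness.

Weak derivatives are converted to primitives, and back, by `eq_primitive_of_hasWeakDeriv` and
`hasWeakDeriv_of_eq_primitive`. Products of absolutely continuous functions with values in Banach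
spaces are differentiated by `bilin_primitive`, which rests on Fubini's theorem.
-/

namespace SineGordon

/-! ### Integration by parts for primitives of integrable functions -/

section Bilinear

variable {E F G : Type*} [NormedAddCommGroup E] [NormedSpace ℝ E]
  [NormedAddCommGroup F] [NormedSpace ℝ F] [NormedAddCommGroup G] [NormedSpace ℝ G]

theorem continuousOn_add_primitive {a b : ℝ} (hab : a ≤ b) (c : E) {p : ℝ → E}
    (hp : IntervalIntegrable p volume a b) :
    ContinuousOn (fun t => c + ∫ s in a..t, p s) (Icc a b) := by
  have h := intervalIntegral.continuousOn_primitive_interval' hp left_mem_uIcc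
  rw [uIcc_of_le hab] at h
  exact continuousOn_const.add h

theorem intervalIntegrable_bilin_left (B : E →L[ℝ] F →L[ℝ] G) {a b : ℝ} (hab : a ≤ b) {p : ℝ → E}
    {Q : ℝ → F} (hp : IntervalIntegrable p volume a b) (hQ : ContinuousOn Q (Icc a b)) :
    IntervalIntegrable (fun s => B (p s) (Q s)) volume a b := by
  obtain ⟨C, hC⟩ := isCompact_Icc.exists_bound_of_continuousOn hQ
  rw [intervalIntegrable_iff_integrableOn_Ioc_of_le hab] at hp ⊢
  refine (hp.norm.const_mul (‖B‖ * C)).mono' ?_ ?_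
  · exact B.aestronglyMeasurable_comp₂ hp.1
      ((hQ.mono Ioc_subset_Icc_self).aestronglyMeasurable measurableSet_Ioc)
  · filter_upwards [ae_restrict_mem measurableSet_Ioc] with s hs
    calc ‖B (p s) (Q s)‖ ≤ ‖B‖ * ‖p s‖ * ‖Q s‖ := B.le_opNorm₂ _ _
      _ ≤ ‖B‖ * ‖p s‖ * C := by gcongr; exact hC s (Ioc_subset_Icc_self hs)
      _ = ‖B‖ * C * ‖p s‖ := by ring

variable [CompleteSpace E] [CompleteSpace F] [CompleteSpace G]

/-- Integration by parts for two primitives that vanish at `a`. The square `(a, b]²` is cut along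
its diagonal, and Fubini's theorem is applied to both halves. -/
theorem bilin_integral_integral (B : E →L[ℝ] F →L[ℝ] G) {a b : ℝ} (hab : a ≤ b) {p : ℝ → E}
    {q : ℝ → F} (hp : IntervalIntegrable p volume a b) (hq : IntervalIntegrable q volume a b) :
    B (∫ s in a..b, p s) (∫ s in a..b, q s) =
      (∫ s in a..b, B (p s) (∫ r in a..s, q r)) + ∫ s in a..b, B (∫ r in a..s, p r) (q s) := by
  rw [intervalIntegrable_iff_integrableOn_Ioc_of_le hab] at hp hq
  set μ : Measure ℝ := volume.restrict (Ioc a b) with hμ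
  have hI : Integrable (fun z : ℝ × ℝ => B (p z.1) (q z.2)) (μ.prod μ) :=
    Integrable.op_fst_snd (op := fun x y => B x y) (by fun_prop) ⟨‖B‖, B.le_opNorm₂⟩ hp hq
  have hD : MeasurableSet {z : ℝ × ℝ | z.2 ≤ z.1} := measurableSet_le measurable_snd measurable_fst
  rw [intervalIntegral.integral_of_le hab, intervalIntegral.integral_of_le hab,
    intervalIntegral.integral_of_le hab, intervalIntegral.integral_of_le hab,
    ← integral_prod_bilin B hp hq, ← integral_add_compl hD hI]
  congr 1
  · rw [← integral_indicator hD, integral_prod _ (hI.indicator hD)]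
    refine setIntegral_congr_fun measurableSet_Ioc fun s hs => ?_
    have h1 : (fun r => indicator {z : ℝ × ℝ | z.2 ≤ z.1} (fun z => B (p z.1) (q z.2)) (s, r))
        = indicator (Iic s) fun r => B (p s) (q r) := by
      ext r
      simp [indicator]
    have h2 : Iic s ∩ Ioc a b = Ioc a s := by
      ext r
      simp only [mem_inter_iff, mem_Iic, mem_Ioc]
      exact ⟨fun h => ⟨h.2.1, h.1⟩, fun h => ⟨h.2, h.1, h.2.trans hs.2⟩⟩
    rw [h1, integral_indicator measurableSet_Iic, hμ, Measure.restrict_restrict measurableSet_Iic,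
      h2, intervalIntegral.integral_of_le hs.1.le]
    exact (B (p s)).integral_comp_comm (hq.mono_set (Ioc_subset_Ioc_right hs.2))
  · rw [← integral_indicator hD.compl, integral_prod_symm _ (hI.indicator hD.compl)]
    refine setIntegral_congr_fun measurableSet_Ioc fun s hs => ?_
    have h1 : (fun r => indicator {z : ℝ × ℝ | z.2 ≤ z.1}ᶜ (fun z => B (p z.1) (q z.2)) (r, s))
        = indicator (Iio s) fun r => B (p r) (q s) := by
      ext r
      simp [indicator]
    have h2 : Iio s ∩ Ioc a b = Ioo a s := by
      ext r
      simp only [mem_inter_iff, mem_Iio, mem_Ioc, mem_Ioo]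
      exact ⟨fun h => ⟨h.2.1, h.1⟩, fun h => ⟨h.2, h.1, h.2.le.trans hs.2⟩⟩
    rw [h1, integral_indicator measurableSet_Iio, hμ, Measure.restrict_restrict measurableSet_Iio,
      h2, ← integral_Ioc_eq_integral_Ioo, intervalIntegral.integral_of_le hs.1.le]
    exact (B.flip (q s)).integral_comp_comm (hp.mono_set (Ioc_subset_Ioc_right hs.2))

/-- Integration by parts for a bilinear map: if `P` and `Q` are primitives on `[a, b]` of the
integrable functions `p` and `q`, then `B(P, Q)` is a primitive of `B(p, Q) + B(P, q)`. -/
theorem bilin_primitive (B : E →L[ℝ] F →L[ℝ] G) {a b : ℝ} (hab : a ≤ b) {p P : ℝ → E}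
    {q Q : ℝ → F} (hp : IntervalIntegrable p volume a b) (hq : IntervalIntegrable q volume a b)
    (hP : ∀ t ∈ Icc a b, P t = P a + ∫ s in a..t, p s)
    (hQ : ∀ t ∈ Icc a b, Q t = Q a + ∫ s in a..t, q s) :
    B (P b) (Q b) = B (P a) (Q a) + ∫ s in a..b, (B (p s) (Q s) + B (P s) (q s)) := by
  have hPc : ContinuousOn P (Icc a b) := (continuousOn_add_primitive hab (P a) hp).congr hP
  have hQc : ContinuousOn Q (Icc a b) := (continuousOn_add_primitive hab (Q a) hq).congr hQ
  have e1 : ∫ s in a..b, B (p s) (Q s) =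
      B (∫ s in a..b, p s) (Q a) + ∫ s in a..b, B (p s) (∫ r in a..s, q r) := by
    have h1 : ∫ s in a..b, B.flip (Q a) (p s) = B.flip (Q a) (∫ s in a..b, p s) :=
      (B.flip (Q a)).intervalIntegral_comp_comm hp
    have h2 := intervalIntegrable_bilin_left B hab hp (continuousOn_add_primitive hab 0 hq)
    simp only [zero_add] at h2
    rw [ContinuousLinearMap.flip_apply] at h1
    rw [← h1, ← intervalIntegral.integral_add]
    · refine intervalIntegral.integral_congr fun s hs => ?_
      rw [uIcc_of_le hab] at hs
      simp [hQ s hs]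
    · simpa using intervalIntegrable_bilin_left B hab hp (Q := fun _ => Q a) continuousOn_const
    · exact h2
  have e2 : ∫ s in a..b, B (P s) (q s) =
      B (P a) (∫ s in a..b, q s) + ∫ s in a..b, B (∫ r in a..s, p r) (q s) := by
    have h1 : ∫ s in a..b, B (P a) (q s) = B (P a) (∫ s in a..b, q s) :=
      (B (P a)).intervalIntegral_comp_comm hq
    have h2 := intervalIntegrable_bilin_left B.flip hab hq (continuousOn_add_primitive hab 0 hp)
    simp only [zero_add, ContinuousLinearMap.flip_apply] at h2
    rw [← h1, ← intervalIntegral.integral_add]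
    · refine intervalIntegral.integral_congr fun s hs => ?_
      rw [uIcc_of_le hab] at hs
      simp [hP s hs]
    · simpa using intervalIntegrable_bilin_left B.flip hab hq (Q := fun _ => P a)
        continuousOn_const
    · exact h2
  have i1 := intervalIntegrable_bilin_left B hab hp hQc
  have i2 := intervalIntegrable_bilin_left B.flip hab hq hPc
  simp only [ContinuousLinearMap.flip_apply] at i2
  rw [intervalIntegral.integral_add i1 i2, e1, e2, hP b (right_mem_Icc.2 hab),
    hQ b (right_mem_Icc.2 hab), map_add, map_add, add_apply,
    add_apply, bilin_integral_integral B hab hp hq]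
  abel

end Bilinear

/-! ### Weak derivatives on `(0, T)` -/

section WeakDerivative

variable {X : Type*} [NormedAddCommGroup X] [NormedSpace ℝ X]

theorem exists_Icc_of_isCompact_subset_Ioo {a b : ℝ} (hab : a < b) {S : Set ℝ} (hS : IsCompact S)
    (h : S ⊆ Ioo a b) : ∃ c d, a < c ∧ c ≤ d ∧ d < b ∧ S ⊆ Icc c d := by
  rcases S.eq_empty_or_nonempty with rfl | hne
  · exact ⟨(a + b) / 2, (a + b) / 2, by linarith, le_rfl, by linarith, empty_subset _⟩
  · obtain ⟨c, hc⟩ := hS.exists_isLeast hne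
    obtain ⟨d, hd⟩ := hS.exists_isGreatest hne
    exact ⟨c, d, (h hc.1).1, hc.2 hd.1, (h hd.1).2, fun x hx => ⟨hc.2 hx, hd.2 hx⟩⟩

theorem IsTestFunction.eq_zero {Ω : Set ℝ} {ψ : ℝ → ℝ} (h : IsTestFunction Ω ψ) {x : ℝ}
    (hx : x ∉ Ω) : ψ x = 0 :=
  image_eq_zero_of_notMem_tsupport fun h' => hx (h.support_subset h')

theorem IsTestFunction.continuous_deriv {Ω : Set ℝ} {ψ : ℝ → ℝ} (h : IsTestFunction Ω ψ) :
    Continuous (deriv ψ) := h.smooth.continuous_deriv (by simp)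

/-- A test function on `(0, T)` with zero integral has a primitive that is a test function. -/
theorem exists_isTestFunction_deriv_eq {T : ℝ} (hT : 0 < T) {θ : ℝ → ℝ}
    (hθ : IsTestFunction (Ioo 0 T) θ) (h0 : ∫ x in Ioo 0 T, θ x = 0) :
    ∃ Ψ, IsTestFunction (Ioo 0 T) Ψ ∧ deriv Ψ = θ := by
  obtain ⟨c, d, hc, hcd, hd, hsub⟩ :=
    exists_Icc_of_isCompact_subset_Ioo hT hθ.compact_support hθ.support_subset
  have hcont := hθ.smooth.continuous
  have hder : ∀ x, HasDerivAt (fun t => ∫ s in (0 : ℝ)..t, θ s) (θ x) x := fun x =>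
    (hcont.integral_hasStrictDerivAt 0 x).hasDerivAt
  have hderiv : deriv (fun t => ∫ s in (0 : ℝ)..t, θ s) = θ := funext fun x => (hder x).deriv
  have hout : ∀ x, x ∉ Icc c d → θ x = 0 := fun x hx =>
    image_eq_zero_of_notMem_tsupport fun h => hx (hsub h)
  have htot : ∫ s in (0 : ℝ)..T, θ s = 0 := by
    rw [intervalIntegral.integral_of_le hT.le, integral_Ioc_eq_integral_Ioo, h0]
  have hz : ∀ t, t ∉ Icc c d → ∫ s in (0 : ℝ)..t, θ s = 0 := by
    intro t ht
    rcases lt_or_ge t c with h | h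
    · refine intervalIntegral.integral_zero_ae (ae_of_all _ fun s hs => hout s fun hs' => ?_)
      have h1 : s ≤ max 0 t := hs.2
      exact absurd (hs'.1.trans h1) (not_le.2 (max_lt hc h))
    · have h' : d < t := not_le.1 fun h' => ht ⟨h, h'⟩
      rw [← intervalIntegral.integral_add_adjacent_intervals (b := T)
        (hcont.intervalIntegrable _ _) (hcont.intervalIntegrable _ _), htot, zero_add]
      refine intervalIntegral.integral_zero_ae (ae_of_all _ fun s hs => hout s fun hs' => ?_)
      have h1 : min T t < s := hs.1
      exact absurd (h1.trans_le hs'.2) (not_lt.2 (le_min hd.le h'.le))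
  have hsupp : tsupport (fun t => ∫ s in (0 : ℝ)..t, θ s) ⊆ Icc c d :=
    closure_minimal (fun t ht => by_contra fun h => ht (hz t h)) isClosed_Icc
  refine ⟨_, ⟨?_, ?_, ?_⟩, hderiv⟩
  · exact contDiff_infty_iff_deriv.2 ⟨fun x => (hder x).differentiableAt,
      by rw [hderiv]; exact hθ.smooth⟩
  · exact isCompact_Icc.of_isClosed_subset (isClosed_tsupport _) hsupp
  · exact hsupp.trans fun x hx => ⟨hc.trans_le hx.1, hx.2.trans_lt hd⟩

theorem exists_isTestFunction_integral_eq_one {T : ℝ} (hT : 0 < T) :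
    ∃ ρ, IsTestFunction (Ioo 0 T) ρ ∧ ∫ x in Ioo 0 T, ρ x = 1 := by
  let f : ContDiffBump (T / 2) := ⟨T / 8, T / 4, by linarith, by linarith⟩
  have hsub : tsupport (f.normed volume) ⊆ Ioo 0 T := by
    rw [f.tsupport_normed_eq, Real.closedBall_eq_Icc]
    intro x hx
    have h1 : T / 2 - T / 4 ≤ x := hx.1
    have h2 : x ≤ T / 2 + T / 4 := hx.2
    exact ⟨by linarith, by linarith⟩
  have ht : IsTestFunction (Ioo 0 T) (f.normed volume) :=
    ⟨f.contDiff_normed, f.hasCompactSupport_normed, hsub⟩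
  refine ⟨_, ht, ?_⟩
  rw [setIntegral_eq_integral_of_forall_compl_eq_zero fun x hx => ht.eq_zero hx, f.integral_normed]

theorem IsTestFunction.sub_const_mul {Ω : Set ℝ} {ψ χ : ℝ → ℝ} (hψ : IsTestFunction Ω ψ)
    (hχ : IsTestFunction Ω χ) (c : ℝ) : IsTestFunction Ω (fun x => ψ x - c * χ x) := by
  refine ⟨hψ.smooth.sub (contDiff_const.mul hχ.smooth), ?_, ?_⟩
  · exact hψ.compact_support.sub (hχ.compact_support.mul_left (f := fun _ => c))
  · have h : tsupport (fun x => ψ x - c * χ x) ⊆ tsupport ψ ∪ tsupport χ := by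
      refine closure_minimal (fun x hx => ?_)
        ((isClosed_tsupport _).union (isClosed_tsupport _))
      by_contra hn
      rw [mem_union, not_or] at hn
      apply hx
      simp [image_eq_zero_of_notMem_tsupport hn.1, image_eq_zero_of_notMem_tsupport hn.2]
    exact h.trans (union_subset hψ.support_subset hχ.support_subset)

theorem IsTestFunction.integrable_smul {Ω : Set ℝ} {ψ : ℝ → ℝ} (hc : Continuous ψ)
    (hs : HasCompactSupport ψ) {u : ℝ → X} (hu : IntegrableOn u Ω) :
    IntegrableOn (fun x => ψ x • u x) Ω :=
  hu.locallyIntegrable.integrable_smul_left_of_hasCompactSupport hc hs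

variable [CompleteSpace X]

/-- A function on `(0, T)` whose weak derivative vanishes is constant. -/
theorem exists_ae_eq_const_of_hasWeakDeriv_zero {T : ℝ} (hT : 0 < T) {u : ℝ → X}
    (hu : IntegrableOn u (Ioo 0 T))
    (h : HasWeakDeriv (Ioo 0 T) u (fun _ => (0 : X))) :
    ∃ c, ∀ᵐ t ∂(timeMeasure T), u t = c := by
  obtain ⟨ρ, hρ, hρ1⟩ := exists_isTestFunction_integral_eq_one hT
  set c := ∫ x in Ioo 0 T, ρ x • u x with hc
  refine ⟨c, ?_⟩
  have key := isOpen_Ioo.ae_eq_zero_of_integral_contDiff_smul_eq_zero (μ := volume)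
    (U := Ioo 0 T) (f := fun t => u t - c)
    (hu.sub (integrableOn_const (by simp))).locallyIntegrableOn ?_
  · rw [ae_restrict_iff' measurableSet_Ioo]
    filter_upwards [key] with t ht ht'
    exact sub_eq_zero.1 (ht ht')
  intro χ hχ1 hχ2 hχ3
  have hχ : IsTestFunction (Ioo 0 T) χ := ⟨hχ1, hχ2, hχ3⟩
  set m := ∫ x in Ioo 0 T, χ x with hm
  have iρ : IntegrableOn ρ (Ioo 0 T) :=
    (hρ.smooth.continuous.integrable_of_hasCompactSupport hρ.compact_support).integrableOn
  have iχ : IntegrableOn χ (Ioo 0 T) :=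
    (hχ.smooth.continuous.integrable_of_hasCompactSupport hχ.compact_support).integrableOn
  obtain ⟨Ψ, hΨ, hΨ'⟩ := exists_isTestFunction_deriv_eq hT (hχ.sub_const_mul hρ m) (by
    rw [integral_sub iχ (iρ.const_mul m), integral_const_mul, hρ1, mul_one, hm, sub_self])
  have h2 := h Ψ hΨ
  have iρu := IsTestFunction.integrable_smul hρ.smooth.continuous hρ.compact_support hu
  have iχu := IsTestFunction.integrable_smul hχ.smooth.continuous hχ.compact_support hu
  rw [hΨ'] at h2
  simp only [smul_zero, integral_zero, neg_zero, sub_smul, mul_smul] at h2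
  rw [integral_sub iχu (iρu.fun_smul m), integral_smul, ← hc, sub_eq_zero] at h2
  rw [← setIntegral_eq_integral_of_forall_compl_eq_zero (s := Ioo 0 T)
    fun x hx => by rw [hχ.eq_zero hx, zero_smul]]
  simp only [smul_sub]
  rw [integral_sub iχu (iχ.smul_const c), h2, integral_smul_const, sub_self]

/-- A primitive of an integrable function has this function as its weak derivative. -/
theorem hasWeakDeriv_of_eq_primitive {T : ℝ} (hT : 0 < T) {u w : ℝ → X} {c : X}
    (hw : IntegrableOn w (Ioo 0 T))
    (h : ∀ᵐ t ∂(timeMeasure T), u t = c + ∫ s in (0 : ℝ)..t, w s) :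
    HasWeakDeriv (Ioo 0 T) u w := by
  intro ψ hψ
  have hw' : IntervalIntegrable w volume 0 T := by
    rwa [intervalIntegrable_iff_integrableOn_Ioo_of_le hT.le]
  have hψ' := hψ.continuous_deriv
  have key := bilin_primitive (ContinuousLinearMap.lsmul ℝ ℝ : ℝ →L[ℝ] X →L[ℝ] X) hT.le
    (p := deriv ψ) (P := ψ) (q := w) (Q := fun t => c + ∫ s in (0 : ℝ)..t, w s)
    (hψ'.intervalIntegrable _ _) hw' (fun t _ => by
      rw [intervalIntegral.integral_deriv_eq_sub
        (fun x _ => (hψ.smooth.differentiable (by simp)).differentiableAt)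
        (hψ'.intervalIntegrable _ _)]
      abel) (fun t _ => by simp)
  have i1 : IntegrableOn (fun t => deriv ψ t • (c + ∫ s in (0 : ℝ)..t, w s)) (Ioo 0 T) :=
    IsTestFunction.integrable_smul hψ' hψ.compact_support.deriv
      (((continuousOn_add_primitive hT.le c hw').integrableOn_Icc).mono_set Ioo_subset_Icc_self)
  have i2 := IsTestFunction.integrable_smul hψ.smooth.continuous hψ.compact_support hw
  simp only [ContinuousLinearMap.lsmul_apply, hψ.eq_zero (x := T) (by simp),
    hψ.eq_zero (x := 0) (by simp), zero_smul, zero_add] at key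
  rw [intervalIntegral.integral_of_le hT.le, integral_Ioc_eq_integral_Ioo,
    integral_add i1 i2] at key
  have e : ∫ t in Ioo 0 T, deriv ψ t • u t
      = ∫ t in Ioo 0 T, deriv ψ t • (c + ∫ s in (0 : ℝ)..t, w s) := by
    refine integral_congr_ae ?_
    filter_upwards [h] with t ht
    rw [ht]
  rw [e]
  exact eq_neg_of_add_eq_zero_left key.symm

/-- A function on `(0, T)` with an integrable weak derivative, and with a continuous representative
of value `c` at `0`, is a.e. equal to the primitive of its weak derivative with value `c` at `0`. -/
theorem eq_primitive_of_hasWeakDeriv {T : ℝ} (hT : 0 < T) {u w : ℝ → X} {c : X}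
    (hw : IntegrableOn w (Ioo 0 T)) (h : HasWeakDeriv (Ioo 0 T) u w)
    (hc : HasContinuousRep T u c) :
    ∀ᵐ t ∂(timeMeasure T), u t = c + ∫ s in (0 : ℝ)..t, w s := by
  obtain ⟨v, hv, hvu, hv0⟩ := hc
  have hw' : IntervalIntegrable w volume 0 T := by
    rwa [intervalIntegrable_iff_integrableOn_Ioo_of_le hT.le]
  have hWc := continuousOn_add_primitive hT.le c hw'
  have iW : IntegrableOn (fun t => c + ∫ s in (0 : ℝ)..t, w s) (Ioo 0 T) :=
    hWc.integrableOn_Icc.mono_set Ioo_subset_Icc_self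
  have iu : IntegrableOn u (Ioo 0 T) :=
    (hv.integrableOn_Icc.mono_set Ioo_subset_Icc_self).congr hvu
  have hWd := hasWeakDeriv_of_eq_primitive hT hw
    (u := fun t => c + ∫ s in (0 : ℝ)..t, w s) (c := c) (ae_of_all _ fun _ => rfl)
  obtain ⟨k, hk⟩ := exists_ae_eq_const_of_hasWeakDeriv_zero hT (iu.sub iW) fun ψ hψ => by
    simp only [Pi.sub_apply, smul_sub, smul_zero, integral_zero, neg_zero]
    rw [integral_sub
      (IsTestFunction.integrable_smul hψ.continuous_deriv hψ.compact_support.deriv iu)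
      (IsTestFunction.integrable_smul hψ.continuous_deriv hψ.compact_support.deriv iW),
      h ψ hψ, hWd ψ hψ, sub_self]
  have heq : EqOn (fun t => v t - (c + ∫ s in (0 : ℝ)..t, w s)) (fun _ => k) (Icc 0 T) := by
    refine Measure.eqOn_Icc_of_ae_eq volume hT.ne ?_ (hv.sub hWc) continuousOn_const
    rw [← Measure.restrict_congr_set Ioo_ae_eq_Icc]
    filter_upwards [hk, hvu] with t h1 h2
    rw [h2]
    exact h1
  have hk0 : k = 0 := by
    have := heq (left_mem_Icc.2 hT.le)
    simpa [hv0] using this.symm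
  filter_upwards [hk] with t ht
  rw [hk0] at ht
  exact sub_eq_zero.1 ht

end WeakDerivative

/-! ### The isometric group generated by the inverse of a skew-adjoint operator -/

section Group

open Filter Topology
open scoped RealInnerProductSpace

variable {X : Type*} [NormedAddCommGroup X] [InnerProductSpace ℝ X]

/-- A bounded operator is skew-adjoint. -/
def IsSkew (A : X →L[ℝ] X) : Prop := ∀ x y, ⟪A x, y⟫ = -⟪x, A y⟫

theorem IsSkew.inner_self_eq_zero {A : X →L[ℝ] X} (hA : IsSkew A) (x : X) : ⟪A x, x⟫ = 0 := by
  have h := hA x x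
  rw [real_inner_comm x (A x)] at h
  rw [real_inner_comm]
  linarith

/-- `S` is the group of isometries `exp(t K⁻¹)`, where `K` is an injective bounded skew-adjoint
operator. That `K⁻¹` is the generator is expressed by the derivative of `t ↦ S(t) K x`. -/
structure IsGroupOfInverse (K : X →L[ℝ] X) (S : ℝ → X →L[ℝ] X) : Prop where
  zero_apply : ∀ x, S 0 x = x
  norm_map : ∀ t x, ‖S t x‖ = ‖x‖
  apply_neg : ∀ t x, S t (S (-t) x) = x
  continuous : ∀ x, Continuous fun t => S t x
  hasDerivAt : ∀ x t, HasDerivAt (fun s => S s (K x)) (S t x) t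

theorem IsGroupOfInverse.inner_left {K : X →L[ℝ] X} {S : ℝ → X →L[ℝ] X}
    (h : IsGroupOfInverse K S) (t : ℝ) (x y : X) : ⟪S t x, y⟫ = ⟪x, S (-t) y⟫ := by
  let U : X →ₗᵢ[ℝ] X := ⟨(S t : X →ₗ[ℝ] X), h.norm_map t⟩
  have := U.inner_map_map x (S (-t) y)
  rw [← this]
  change _ = ⟪S t x, S t (S (-t) y)⟫
  rw [h.apply_neg]

theorem exp_smul_apply_comm {A K : X →L[ℝ] X} (h : ∀ x, A (K x) = K (A x)) (t : ℝ) (x : X) :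
    NormedSpace.exp (t • A) (K x) = K (NormedSpace.exp (t • A) x) := by
  have hc : Commute K (t • A) := by
    refine Commute.smul_right ?_ t
    ext y
    exact (h y).symm
  exact (congrArg (fun T : X →L[ℝ] X => T x) hc.exp_right.eq).symm

variable [CompleteSpace X]

theorem exp_smul_apply_hasDerivAt (A : X →L[ℝ] X) (x : X) (t : ℝ) :
    HasDerivAt (fun s : ℝ => NormedSpace.exp (s • A) x) (A (NormedSpace.exp (t • A) x)) t :=
  (hasDerivAt_exp_smul_const' A t).clm_apply (hasDerivAt_const t x) |>.congr_deriv (by simp)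

theorem exp_smul_apply_neg (A : X →L[ℝ] X) (t : ℝ) (x : X) :
    NormedSpace.exp (t • A) (NormedSpace.exp ((-t) • A) x) = x := by
  let _ : NormedAlgebra ℚ (X →L[ℝ] X) := NormedAlgebra.restrictScalars ℚ ℝ _
  have hc : Commute (t • A) ((-t) • A) := ((Commute.refl A).smul_left t).smul_right (-t)
  have h := NormedSpace.exp_add_of_commute hc
  rw [← add_smul, add_neg_cancel, zero_smul, NormedSpace.exp_zero] at h
  exact (congrArg (fun T : X →L[ℝ] X => T x) h).symm

theorem IsSkew.norm_exp_smul_apply {A : X →L[ℝ] X} (hA : IsSkew A) (t : ℝ) (x : X) :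
    ‖NormedSpace.exp (t • A) x‖ = ‖x‖ := by
  have hd : ∀ s, HasDerivAt (fun s : ℝ => ‖NormedSpace.exp (s • A) x‖ ^ 2) 0 s := fun s => by
    refine (exp_smul_apply_hasDerivAt A x s).norm_sq.congr_deriv ?_
    rw [real_inner_comm, hA.inner_self_eq_zero, mul_zero]
  have h := is_const_of_deriv_eq_zero (fun s => (hd s).differentiableAt)
    (fun s => (hd s).deriv) t 0
  simp only [zero_smul, NormedSpace.exp_zero, one_apply_eq_self] at h
  exact (sq_eq_sq₀ (norm_nonneg _) (norm_nonneg _)).1 h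

/-- Comparison of two groups with bounded generators, one of them isometric. -/
theorem norm_exp_smul_sub_le {A B : X →L[ℝ] X} (hA : IsSkew A) {x : X} {C : ℝ}
    (hC : ∀ s : ℝ, ‖(B - A) (NormedSpace.exp (s • B) x)‖ ≤ C) (t : ℝ) :
    ‖NormedSpace.exp (t • B) x - NormedSpace.exp (t • A) x‖ ≤ C * |t| := by
  have hd : ∀ s : ℝ, HasDerivAt
      (fun s : ℝ => NormedSpace.exp ((-s) • A) (NormedSpace.exp (s • B) x))
      (NormedSpace.exp ((-s) • A) ((B - A) (NormedSpace.exp (s • B) x))) s := by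
    intro s
    have h1 : HasDerivAt (fun s : ℝ => NormedSpace.exp ((-s) • A))
        (-(NormedSpace.exp ((-s) • A) * A)) s := by
      have := (hasDerivAt_exp_smul_const A (-s)).scomp s (hasDerivAt_neg s)
      simpa [Function.comp_def] using this
    refine (h1.clm_apply (exp_smul_apply_hasDerivAt B x s)).congr_deriv ?_
    simp only [neg_apply, mul_apply_eq_comp,
      sub_apply, map_sub]
    abel
  have hb := Convex.norm_image_sub_le_of_norm_hasDerivWithin_le (s := univ) (x := 0) (y := t)
    (fun s _ => (hd s).hasDerivWithinAt)
    (fun s _ => by rw [hA.norm_exp_smul_apply]; exact hC s) convex_univ trivial trivial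
  simp only [neg_zero, zero_smul, NormedSpace.exp_zero, one_apply_eq_self, sub_zero,
    Real.norm_eq_abs] at hb
  rw [← hA.norm_exp_smul_apply t, map_sub, exp_smul_apply_neg] at hb
  exact hb

/-- For skew-adjoint `K` and `δ > 0` the operator `δ - K²` is invertible, by the Lax-Milgram
theorem. -/
theorem IsSkew.exists_resolvent {K : X →L[ℝ] X} (hK : IsSkew K) {δ : ℝ} (hδ : 0 < δ) :
    ∃ R : X →L[ℝ] X, (∀ x, δ • R x - K (K (R x)) = x) ∧ (∀ x, R (K x) = K (R x)) ∧
      (∀ x y, ⟪R x, y⟫ = ⟪x, R y⟫) ∧ ∀ x, ‖δ • R x‖ ≤ ‖x‖ := by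
  let M : X →L[ℝ] X := δ • ContinuousLinearMap.id ℝ X - K.comp K
  have hM : ∀ x, M x = δ • x - K (K x) := fun x => rfl
  let B : X →L[ℝ] X →L[ℝ] ℝ := (innerSL ℝ : X →L[ℝ] X →L[ℝ] ℝ).comp M
  have hB : ∀ x y, B x y = ⟪M x, y⟫ := fun x y => rfl
  have hMx : ∀ x, δ * ‖x‖ * ‖x‖ ≤ ⟪M x, x⟫ := fun x => by
    rw [hM, inner_sub_left, hK, real_inner_smul_left, real_inner_self_eq_norm_mul_norm,
      real_inner_self_eq_norm_mul_norm]
    nlinarith [norm_nonneg (K x)]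
  have hco : IsCoercive B := ⟨δ, hδ, hMx⟩
  let e := hco.continuousLinearEquivOfBilin
  have he : ∀ x, e x = M x := fun x => by
    refine ext_inner_right ℝ fun y => ?_
    rw [hco.continuousLinearEquivOfBilin_apply, hB]
  have hMR : ∀ x, M (e.symm x) = x := fun x => by rw [← he, e.apply_symm_apply]
  have hMs : ∀ x y, ⟪M x, y⟫ = ⟪x, M y⟫ := fun x y => by
    rw [hM, hM, inner_sub_left, inner_sub_right, hK, hK x, real_inner_smul_left,
      real_inner_smul_right, neg_neg]
  refine ⟨e.symm, fun x => ?_, fun x => ?_, fun x y => ?_, fun x => ?_⟩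
  · exact hMR x
  · apply e.injective
    rw [ContinuousLinearEquiv.coe_coe, e.apply_symm_apply, he]
    have : M (K (e.symm x)) = K (M (e.symm x)) := by simp [hM]
    rw [this, hMR]
  · have := hMs (e.symm x) (e.symm y)
    rw [hMR, hMR] at this
    exact this.symm
  · have h1 := hMx (e.symm x)
    rw [hMR] at h1
    have h2 := h1.trans (real_inner_le_norm _ _)
    rw [norm_smul, Real.norm_eq_abs, abs_of_pos hδ]
    rcases (norm_nonneg (e.symm x)).eq_or_lt with h0 | h0
    · have h3 : ‖(e.symm : X →L[ℝ] X) x‖ = 0 := h0.symm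
      rw [h3, mul_zero]
      exact norm_nonneg x
    · exact le_of_mul_le_mul_right h2 h0

/-- Bounded skew-adjoint approximations `A = -K (δ - K²)⁻¹` of the unbounded operator `K⁻¹`. -/
theorem IsSkew.exists_approx_inverse {K : X →L[ℝ] X} (hK : IsSkew K) {δ : ℝ} (hδ : 0 < δ) :
    ∃ A : X →L[ℝ] X, IsSkew A ∧ (∀ x, A (K x) = K (A x)) ∧ (∀ x, ‖A (K x) - x‖ ≤ ‖x‖) ∧
      ∀ x, ‖A (K (K (K x))) - K (K x)‖ ≤ 2 * δ * ‖x‖ := by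
  obtain ⟨R, h1, h2, h3, h4⟩ := hK.exists_resolvent hδ
  have hAK : ∀ x, -K (R (K x)) - x = -(δ • R x) := fun x => by
    rw [h2]
    nth_rewrite 2 [← h1 x]
    abel
  refine ⟨-(K.comp R), fun x y => ?_, fun x => ?_, fun x => ?_, fun x => ?_⟩
  · simp only [neg_apply, ContinuousLinearMap.comp_apply, inner_neg_left,
      inner_neg_right]
    rw [hK, h3, h2]
  · simp [h2]
  · simpa [hAK] using h4 x
  · simp only [neg_apply, ContinuousLinearMap.comp_apply]
    have h5 : K (K (R x)) = δ • R x - x := by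
      nth_rewrite 3 [← h1 x]
      abel
    rw [hAK, h2, h2, h5, norm_neg, norm_smul, Real.norm_eq_abs, abs_of_pos hδ]
    calc δ * ‖δ • R x - x‖ ≤ δ * (‖δ • R x‖ + ‖x‖) := by gcongr; exact norm_sub_le _ _
      _ ≤ δ * (‖x‖ + ‖x‖) := by gcongr; exact h4 x
      _ = 2 * δ * ‖x‖ := by ring

theorem IsSkew.denseRange {K : X →L[ℝ] X} (hK : IsSkew K) (hinj : Function.Injective K) :
    DenseRange K := by
  have h : Dense ((K : X →ₗ[ℝ] X).range : Set X) := by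
    rw [Submodule.dense_iff_topologicalClosure_eq_top, Submodule.topologicalClosure_eq_top_iff,
      Submodule.eq_bot_iff]
    intro y hy
    have h1 : ⟪K (K y), y⟫ = 0 := (Submodule.mem_orthogonal _ _).1 hy _ ⟨K y, rfl⟩
    rw [hK, neg_eq_zero, _root_.inner_self_eq_zero] at h1
    exact hinj (h1.trans K.map_zero.symm)
  exact h

/-- Stone's theorem, for the inverse of a bounded operator: the inverse of an injective bounded
skew-adjoint operator `K` generates a strongly continuous group of isometries. The group is the
strong limit of the groups generated by `-K (δ - K²)⁻¹` as `δ → 0`; the limit exists on the range of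
`K³`, which is dense. -/
theorem IsSkew.exists_isGroupOfInverse {K : X →L[ℝ] X} (hK : IsSkew K)
    (hinj : Function.Injective K) : ∃ S : ℝ → X →L[ℝ] X, IsGroupOfInverse K S := by
  have hpos : ∀ n : ℕ, 0 < 1 / ((n : ℝ) + 1) := fun n => Nat.one_div_pos_of_nat
  choose A hAs hAK hAb hAe using fun n : ℕ => hK.exists_approx_inverse (hpos n)
  set U : ℕ → ℝ → X →L[ℝ] X := fun n t => NormedSpace.exp (t • A n) with hU
  have hUn : ∀ n t x, ‖U n t x‖ = ‖x‖ := fun n t x => (hAs n).norm_exp_smul_apply t x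
  have hUK : ∀ n t x, U n t (K x) = K (U n t x) := fun n t x => exp_smul_apply_comm (hAK n) t x
  have hδ : Tendsto (fun n : ℕ => 1 / ((n : ℝ) + 1)) atTop (𝓝 0) :=
    tendsto_one_div_add_atTop_nhds_zero_nat
  have hdense : DenseRange fun x => K (K (K x)) := by
    have h := hK.denseRange hinj
    have h2 : DenseRange fun x => K (K x) := h.comp h K.continuous
    exact h.comp h2 K.continuous
  have hAlim : ∀ x, Tendsto (fun n => A n (K x) - x) atTop (𝓝 0) := by
    intro x
    rw [Metric.tendsto_atTop]
    intro ε hε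
    obtain ⟨z, hz⟩ := ((hK.denseRange hinj).comp (hK.denseRange hinj) K.continuous).exists_dist_lt x
      (half_pos hε)
    have hlim : Tendsto (fun n : ℕ => 2 * (1 / ((n : ℝ) + 1)) * ‖z‖) atTop (𝓝 0) := by
      simpa using (hδ.const_mul 2).mul_const ‖z‖
    obtain ⟨N, hN⟩ := eventually_atTop.1 (hlim.eventually_lt_const (half_pos hε))
    refine ⟨N, fun n hn => ?_⟩
    have e : A n (K x) - x = (A n (K (x - K (K z))) - (x - K (K z))) +
        (A n (K (K (K z))) - K (K z)) := by
      simp only [map_sub]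
      abel
    rw [dist_zero_right, e]
    rw [dist_eq_norm] at hz
    calc _ ≤ ‖x - K (K z)‖ + 2 * (1 / ((n : ℝ) + 1)) * ‖z‖ :=
          (norm_add_le _ _).trans (add_le_add (hAb n _) (hAe n z))
      _ < ε / 2 + ε / 2 := add_lt_add hz (hN n hn)
      _ = ε := add_halves ε
  have hcauchy : ∀ t x, CauchySeq fun n => U n t x := by
    intro t x
    rw [Metric.cauchySeq_iff']
    intro ε hε
    obtain ⟨z, hz⟩ := hdense.exists_dist_lt x (show 0 < ε / 4 by linarith)
    have hlim : Tendsto (fun n : ℕ => 4 * (1 / ((n : ℝ) + 1)) * ‖z‖ * |t|) atTop (𝓝 0) := by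
      simpa using ((hδ.const_mul 4).mul_const ‖z‖).mul_const |t|
    obtain ⟨N, hN⟩ := eventually_atTop.1 (hlim.eventually_lt_const (half_pos hε))
    refine ⟨N, fun n hn => ?_⟩
    have hnN : 1 / ((n : ℝ) + 1) ≤ 1 / ((N : ℝ) + 1) := by
      apply one_div_le_one_div_of_le (by positivity)
      have : (N : ℝ) ≤ n := by exact_mod_cast hn
      linarith
    have hcmp : ‖U n t (K (K (K z))) - U N t (K (K (K z)))‖ ≤
        4 * (1 / ((N : ℝ) + 1)) * ‖z‖ * |t| := by
      refine norm_exp_smul_sub_le (hAs N) (fun s => ?_) t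
      have e : (A n - A N) (U n s (K (K (K z)))) =
          (A n (K (K (K (U n s z)))) - K (K (U n s z))) -
            (A N (K (K (K (U n s z)))) - K (K (U n s z))) := by
        simp only [hUK, sub_apply]
        abel
      change ‖(A n - A N) (U n s (K (K (K z))))‖ ≤ _
      rw [e]
      refine (norm_sub_le _ _).trans ((add_le_add (hAe n _) (hAe N _)).trans ?_)
      rw [hUn]
      have := mul_le_mul_of_nonneg_right hnN (norm_nonneg z)
      linarith
    have e : U n t x - U N t x = U n t (x - K (K (K z))) +
        (U n t (K (K (K z))) - U N t (K (K (K z)))) - U N t (x - K (K (K z))) := by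
      simp only [map_sub]
      abel
    rw [dist_eq_norm] at hz ⊢
    rw [e]
    calc _ ≤ ‖x - K (K (K z))‖ + 4 * (1 / ((N : ℝ) + 1)) * ‖z‖ * |t| + ‖x - K (K (K z))‖ := by
          refine (norm_sub_le _ _).trans (add_le_add ((norm_add_le _ _).trans ?_) (hUn _ _ _).le)
          exact add_le_add (hUn _ _ _).le hcmp
      _ < ε / 4 + ε / 2 + ε / 4 := add_lt_add (add_lt_add hz (hN N le_rfl)) hz
      _ = ε := by ring
  choose s hs using fun t x => cauchySeq_tendsto_of_complete (hcauchy t x)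
  have hsn : ∀ t x, ‖s t x‖ = ‖x‖ := fun t x =>
    tendsto_nhds_unique (hs t x).norm (by simp [hUn])
  let S : ℝ → X →L[ℝ] X := fun t =>
    LinearMap.mkContinuous
      { toFun := s t
        map_add' := fun x y => tendsto_nhds_unique (hs t (x + y))
          (by simpa using (hs t x).add (hs t y))
        map_smul' := fun c x => tendsto_nhds_unique (hs t (c • x))
          (by simpa using (hs t x).const_smul c) } 1 (fun x => by simp [hsn])
  have hS : ∀ t x, Tendsto (fun n => U n t x) atTop (𝓝 (S t x)) := hs
  have hSn : ∀ t x, ‖S t x‖ = ‖x‖ := hsn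
  have hUc : ∀ n x, Continuous fun t => U n t x := fun n x =>
    continuous_iff_continuousAt.2 fun t => (exp_smul_apply_hasDerivAt (A n) x t).continuousAt
  have hSm : ∀ x, StronglyMeasurable fun t => S t x := fun x =>
    stronglyMeasurable_of_tendsto atTop (fun n => (hUc n x).stronglyMeasurable)
      (tendsto_pi_nhds.2 fun t => hS t x)
  have hSi : ∀ x a b, IntervalIntegrable (fun t => S t x) volume a b := fun x a b =>
    (intervalIntegrable_const (c := ‖x‖)).mono_fun (hSm x).aestronglyMeasurable
      (ae_of_all _ fun t => by simp [hSn])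
  -- the integrated form of `d/dt S(t) K x = S(t) x`, by passage to the limit
  have hint : ∀ x a b, S b (K x) - S a (K x) = ∫ t in a..b, S t x := by
    intro x a b
    have h1 : ∀ n, U n b (K x) - U n a (K x) = ∫ t in a..b, U n t (A n (K x)) := fun n => by
      have hd : ∀ t, HasDerivAt (fun t => U n t (K x)) (U n t (A n (K x))) t := fun t => by
        refine (exp_smul_apply_hasDerivAt (A n) (K x) t).congr_deriv ?_
        exact (exp_smul_apply_comm (fun _ => rfl) t (K x)).symm
      exact (intervalIntegral.integral_eq_sub_of_hasDerivAt (fun t _ => hd t)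
        ((hUc n _).intervalIntegrable _ _)).symm
    have h2 : Tendsto (fun n => ∫ t in a..b, U n t (A n (K x))) atTop (𝓝 (∫ t in a..b, S t x)) := by
      refine intervalIntegral.tendsto_integral_filter_of_dominated_convergence
        (fun _ => 2 * ‖x‖) (Eventually.of_forall fun n => (hUc n _).aestronglyMeasurable)
        (Eventually.of_forall fun n => ae_of_all _ fun t _ => ?_) intervalIntegrable_const
        (ae_of_all _ fun t _ => ?_)
      · rw [hUn]
        have := norm_add_le (A n (K x) - x) x
        rw [sub_add_cancel] at this
        linarith [hAb n x]
      · have h3 : Tendsto (fun n => U n t (A n (K x) - x)) atTop (𝓝 0) := by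
          rw [tendsto_zero_iff_norm_tendsto_zero]
          simp only [hUn]
          simpa using (hAlim x).norm
        simpa using h3.add (hS t x)
    exact tendsto_nhds_unique (((hS b _).sub (hS a _)).congr h1) h2
  have hScont : ∀ x, Continuous fun t => S t x := by
    intro x
    rw [Metric.continuous_iff]
    intro t ε hε
    obtain ⟨z, hz⟩ := (hK.denseRange hinj).exists_dist_lt x (show 0 < ε / 4 by linarith)
    refine ⟨ε / (4 * (‖z‖ + 1)), by positivity, fun r hr => ?_⟩
    have h1 : ‖S r (K z) - S t (K z)‖ ≤ ‖z‖ * |r - t| := by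
      rw [hint]
      exact intervalIntegral.norm_integral_le_of_norm_le_const fun _ _ => (hSn _ _).le
    rw [Real.dist_eq] at hr
    have h2 : ‖z‖ * |r - t| ≤ ε / 4 := by
      calc ‖z‖ * |r - t| ≤ (‖z‖ + 1) * (ε / (4 * (‖z‖ + 1))) := by gcongr; linarith
        _ = ε / 4 := by field_simp
    have e : S r x - S t x = S r (x - K z) + (S r (K z) - S t (K z)) - S t (x - K z) := by
      simp only [map_sub]
      abel
    rw [dist_eq_norm] at hz ⊢
    rw [e]
    calc _ ≤ ‖x - K z‖ + ε / 4 + ‖x - K z‖ := by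
          refine (norm_sub_le _ _).trans (add_le_add ((norm_add_le _ _).trans ?_) (hSn _ _).le)
          exact add_le_add (hSn _ _).le (h1.trans h2)
      _ < ε / 4 + ε / 4 + ε / 4 := by linarith
      _ ≤ ε := by linarith
  refine ⟨S, ⟨fun x => ?_, hSn, fun t x => ?_, hScont, fun x t => ?_⟩⟩
  · refine tendsto_nhds_unique (hS 0 x) ?_
    simp [hU]
  · have h1 : Tendsto (fun n => U n t (U n (-t) x - S (-t) x)) atTop (𝓝 0) := by
      rw [tendsto_zero_iff_norm_tendsto_zero]
      simp only [hUn]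
      simpa using ((hS (-t) x).sub_const (S (-t) x)).norm
    have h2 := h1.add (hS t (S (-t) x))
    simp only [map_sub, sub_add_cancel, zero_add] at h2
    refine tendsto_nhds_unique h2 ?_
    simp only [hU, exp_smul_apply_neg]
    exact tendsto_const_nhds
  · have h1 := ((hScont x).integral_hasStrictDerivAt 0 t).hasDerivAt.const_add (S 0 (K x))
    refine h1.congr_of_eventuallyEq (Eventually.of_forall fun r => ?_)
    simp only [← hint]
    abel

end Group

/-! ### Integral equations: Picard iteration and Gronwall's inequality -/

section IntegralEquation

open Filter Topology

theorem intervalIntegrable_of_integrableOn_Ioo {E : Type*} [NormedAddCommGroup E] {T : ℝ}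
    (hT : 0 < T) {f : ℝ → E} (hf : IntegrableOn f (Ioo 0 T)) {t : ℝ} (ht : t ∈ Icc 0 T) :
    IntervalIntegrable f volume 0 t := by
  rw [← intervalIntegrable_iff_integrableOn_Ioo_of_le hT.le] at hf
  refine hf.mono_set ?_
  rw [uIcc_of_le ht.1, uIcc_of_le hT.le]
  exact Icc_subset_Icc_right ht.2

variable {E : Type*} [NormedAddCommGroup E] [NormedSpace ℝ E]

/-- The integral equation `Y(t) = x₀ + ∫₀ᵗ F(s, Y(s)) ds`, with `F` Lipschitz in its second variable
and only integrable in the first, has a continuous solution on `[0, T]`: by the usual estimate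
`(M t)ⁿ / n!`, some iterate of the Picard map is a contraction of `C([0, T]; E)`. -/
theorem exists_integralEquation_solution [CompleteSpace E] {T : ℝ} (hT : 0 < T) {F : ℝ → E → E}
    {M : ℝ} (hM : 0 ≤ M) (hLip : ∀ t x y, ‖F t x - F t y‖ ≤ M * ‖x - y‖)
    (hint : ∀ Y : ℝ → E, Continuous Y → IntegrableOn (fun s => F s (Y s)) (Ioo 0 T)) (x₀ : E) :
    ∃ Y : ℝ → E, Continuous Y ∧ ∀ t ∈ Icc 0 T, Y t = x₀ + ∫ s in (0 : ℝ)..t, F s (Y s) := by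
  let ext : C(Icc 0 T, E) → ℝ → E := fun y => IccExtend hT.le y
  have hext : ∀ y, Continuous (ext y) := fun y => y.continuous.Icc_extend'
  have hextv : ∀ y (t : ℝ) (ht : t ∈ Icc 0 T), ext y t = y ⟨t, ht⟩ := fun y t ht =>
    IccExtend_of_mem hT.le y ht
  have hI : ∀ y (t : ℝ), t ∈ Icc 0 T →
      IntervalIntegrable (fun s => F s (ext y s)) volume 0 t := fun y t ht =>
    intervalIntegrable_of_integrableOn_Ioo hT (hint _ (hext y)) ht
  let Φ : C(Icc 0 T, E) → C(Icc 0 T, E) := fun y =>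
    ⟨fun t => x₀ + ∫ s in (0 : ℝ)..t, F s (ext y s), continuousOn_iff_continuous_domRestrict.1
      (continuousOn_add_primitive hT.le x₀ (hI y T (right_mem_Icc.2 hT.le)))⟩
  have hΦ : ∀ y t, Φ y t = x₀ + ∫ s in (0 : ℝ)..t, F s (ext y s) := fun _ _ => rfl
  have hest : ∀ (n : ℕ) (y z : C(Icc 0 T, E)) (t : Icc 0 T),
      ‖Φ^[n] y t - Φ^[n] z t‖ ≤ (M * t) ^ n / n.factorial * ‖y - z‖ := by
    intro n
    induction n with
    | zero =>
      intro y z t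
      simpa using (y - z).norm_coe_le_norm t
    | succ n ih =>
      intro y z t
      rw [Function.iterate_succ_apply', Function.iterate_succ_apply', hΦ, hΦ,
        add_sub_add_left_eq_sub,
        ← intervalIntegral.integral_sub (hI _ _ t.2) (hI _ _ t.2)]
      have hc : Continuous fun s : ℝ => M * ((M * s) ^ n / n.factorial * ‖y - z‖) := by fun_prop
      refine (intervalIntegral.norm_integral_le_of_norm_le t.2.1
        (ae_of_all _ fun s hs => ?_) (hc.intervalIntegrable 0 t)).trans_eq ?_
      · have hs' : s ∈ Icc 0 T := ⟨hs.1.le, hs.2.trans t.2.2⟩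
        refine (hLip _ _ _).trans (mul_le_mul_of_nonneg_left ?_ hM)
        rw [hextv _ s hs', hextv _ s hs']
        exact ih y z ⟨s, hs'⟩
      · have e : (fun s : ℝ => M * ((M * s) ^ n / n.factorial * ‖y - z‖)) =
            fun s : ℝ => (M ^ (n + 1) / n.factorial * ‖y - z‖) * s ^ n := by
          ext s
          rw [mul_pow]
          ring
        rw [e, intervalIntegral.integral_const_mul, integral_pow, Nat.factorial_succ]
        push_cast
        field_simp
        simp [mul_pow]
        ring
  have hlim := FloorSemiring.tendsto_pow_div_factorial_atTop (M * T)
  obtain ⟨n, hn⟩ := (hlim.eventually_lt_const one_pos).exists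
  have hn0 : 0 ≤ (M * T) ^ n / n.factorial := by positivity
  have hcontr : ContractingWith ⟨_, hn0⟩ (Φ^[n]) := by
    refine ⟨by exact_mod_cast hn, LipschitzWith.of_dist_le_mul fun y z => ?_⟩
    rw [dist_eq_norm, dist_eq_norm]
    refine (ContinuousMap.norm_le _ (by positivity)).2 fun t => ?_
    refine (hest n y z t).trans (mul_le_mul_of_nonneg_right ?_ (norm_nonneg _))
    have h1 : (t : ℝ) ≤ T := t.2.2
    have h0 : (0 : ℝ) ≤ t := t.2.1
    change _ ≤ (M * T) ^ n / n.factorial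
    gcongr
  have hfix := hcontr.isFixedPt_fixedPoint_iterate
  set y := ContractingWith.fixedPoint (Φ^[n]) hcontr
  refine ⟨ext y, hext y, fun t ht => ?_⟩
  rw [hextv y t ht]
  nth_rewrite 1 [← hfix.eq]
  rw [hΦ]

/-- Gronwall's inequality for a function dominated by a multiple of its primitive. -/
theorem eq_zero_of_le_mul_integral {T C : ℝ} (hT : 0 < T) {N : ℝ → ℝ}
    (hN : ContinuousOn N (Icc 0 T)) (h0 : ∀ t ∈ Icc 0 T, 0 ≤ N t)
    (h : ∀ t ∈ Icc 0 T, N t ≤ C * ∫ s in (0 : ℝ)..t, N s) : ∀ t ∈ Icc 0 T, N t = 0 := by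
  let n : ℝ → ℝ := IccExtend hT.le ((Icc 0 T).domRestrict N)
  have hn : Continuous n := (continuousOn_iff_continuous_domRestrict.1 hN).Icc_extend'
  have hnv : ∀ t ∈ Icc 0 T, n t = N t := fun t ht => IccExtend_of_mem hT.le _ ht
  have hint : ∀ t ∈ Icc 0 T, ∫ s in (0 : ℝ)..t, N s = ∫ s in (0 : ℝ)..t, n s := fun t ht =>
    intervalIntegral.integral_congr fun s hs => by
      rw [uIcc_of_le ht.1] at hs
      exact (hnv s ⟨hs.1, hs.2.trans ht.2⟩).symm
  have hd : ∀ t, HasDerivAt (fun t => ∫ s in (0 : ℝ)..t, n s) (n t) t := fun t =>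
    (hn.integral_hasStrictDerivAt 0 t).hasDerivAt
  have hpos : ∀ t ∈ Icc 0 T, 0 ≤ ∫ s in (0 : ℝ)..t, n s := fun t ht =>
    intervalIntegral.integral_nonneg ht.1 fun s hs => by
      rw [hnv s ⟨hs.1, hs.2.trans ht.2⟩]
      exact h0 s ⟨hs.1, hs.2.trans ht.2⟩
  have key := eq_zero_of_abs_deriv_le_mul_abs_self_of_eq_zero_right
    (f := fun t => ∫ s in (0 : ℝ)..t, n s) (f' := n) (K := C) (a := 0) (b := T)
    (fun t _ => (hd t).continuousAt.continuousWithinAt)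
    (fun t _ => (hd t).hasDerivWithinAt) (by simp) (fun t ht => by
      have ht' := Ico_subset_Icc_self ht
      rw [Real.norm_eq_abs, Real.norm_eq_abs, hnv t ht', abs_of_nonneg (h0 t ht'),
        abs_of_nonneg (hpos t ht'), ← hint t ht']
      exact h t ht')
  intro t ht
  refine le_antisymm ?_ (h0 t ht)
  have := h t ht
  rwa [hint t ht, key t ht, mul_zero] at this

end IntegralEquation

/-! ### Abstract semilinear wave equations -/

section Evolution

open scoped RealInnerProductSpace

/-- The inner product of a real Hilbert space as a continuous bilinear map, without the conjugation
of `innerSL`. -/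
noncomputable def realInner (X : Type*) [NormedAddCommGroup X] [InnerProductSpace ℝ X] :
    X →L[ℝ] X →L[ℝ] ℝ := innerSL ℝ

theorem realInner_apply {X : Type*} [NormedAddCommGroup X] [InnerProductSpace ℝ X] (x y : X) :
    realInner X x y = ⟪x, y⟫ := rfl

theorem IsGroupOfInverse.continuous_uncurry {X : Type*} [NormedAddCommGroup X]
    [InnerProductSpace ℝ X] {K : X →L[ℝ] X} {S : ℝ → X →L[ℝ] X} (h : IsGroupOfInverse K S) :
    Continuous fun p : ℝ × X => S p.1 p.2 :=
  continuous_prod_of_continuous_lipschitzWith' _ 1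
    (fun t => LipschitzWith.of_dist_le_mul fun x y => by
      simp [dist_eq_norm, ← map_sub, h.norm_map]) fun x => h.continuous x

/-- The mild solution of `x' = K⁻¹ x + b(t, x)`, `x(0) = x₀`, satisfies this equation after
application of `K`. With `x(t) = S(t) Y(t)` the equation for `Y` is
`Y' = S(-t) b(t, S(t) Y)`, whose right-hand side is Lipschitz in `Y`. -/
theorem IsSkew.exists_mild_solution {X : Type*} [NormedAddCommGroup X] [InnerProductSpace ℝ X]
    [CompleteSpace X] {K : X →L[ℝ] X} (hK : IsSkew K) (hinj : Function.Injective K) {T : ℝ}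
    (hT : 0 < T) {b : ℝ → X → X} {M : ℝ} (hM : 0 ≤ M)
    (hLip : ∀ t x y, ‖b t x - b t y‖ ≤ M * ‖x - y‖)
    (hint : ∀ Y : ℝ → X, Continuous Y → IntegrableOn (fun s => b s (Y s)) (Ioo 0 T)) (x₀ : X) :
    ∃ x : ℝ → X, Continuous x ∧ x 0 = x₀ ∧
      ∀ t ∈ Icc 0 T, K (x t) = K x₀ + ∫ s in (0 : ℝ)..t, (x s + K (b s (x s))) := by
  obtain ⟨S, hS⟩ := hK.exists_isGroupOfInverse hinj
  have hSc := hS.continuous_uncurry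
  obtain ⟨Y, hYc, hY⟩ := exists_integralEquation_solution hT
    (F := fun s y => S (-s) (b s (S s y))) hM (fun t x y => by
      rw [← map_sub, hS.norm_map]
      refine (hLip _ _ _).trans_eq ?_
      rw [← map_sub, hS.norm_map]) (fun Y hY => by
      have h1 := hint (fun s => S s (Y s)) (hSc.comp (continuous_id.prodMk hY))
      refine h1.norm.mono' ?_ (ae_of_all _ fun s => by rw [hS.norm_map])
      exact hSc.comp_aestronglyMeasurable (f := fun s => (-s, b s (S s (Y s))))
        (continuous_neg.aestronglyMeasurable.prodMk h1.1)) x₀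
  have hY0 : Y 0 = x₀ := by simpa using hY 0 (left_mem_Icc.2 hT.le)
  have hxc : Continuous fun t => S t (Y t) := hSc.comp (continuous_id.prodMk hYc)
  have hb := hint _ hxc
  have hFi : IntegrableOn (fun s => S (-s) (b s (S s (Y s)))) (Ioo 0 T) := by
    refine hb.norm.mono' ?_ (ae_of_all _ fun s => by rw [hS.norm_map])
    exact hSc.comp_aestronglyMeasurable (f := fun s => (-s, b s (S s (Y s))))
      (continuous_neg.aestronglyMeasurable.prodMk hb.1)
  refine ⟨fun t => S t (Y t), hxc, by simp [hS.zero_apply, hY0], fun t ht => ?_⟩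
  have hsub : ∀ r ∈ Icc 0 t, r ∈ Icc 0 T := fun r hr => ⟨hr.1, hr.2.trans ht.2⟩
  refine ext_inner_right ℝ fun z => ?_
  have hder : ∀ s, HasDerivAt (fun s => S (-s) (K z)) (-S (-s) z) s := fun s => by
    have := (hS.hasDerivAt z (-s)).scomp s (hasDerivAt_neg s)
    simpa [Function.comp_def] using this
  have hqc : Continuous fun s => -S (-s) z := ((hS.continuous z).comp continuous_neg).neg
  have key := bilin_primitive (realInner X) ht.1
    (p := fun s => S (-s) (b s (S s (Y s)))) (P := Y) (q := fun s => -S (-s) z)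
    (Q := fun s => S (-s) (K z)) (intervalIntegrable_of_integrableOn_Ioo hT hFi ht)
    (hqc.intervalIntegrable _ _) (fun r hr => by rw [hY0]; exact hY r (hsub r hr))
    (fun r _ => by
      rw [intervalIntegral.integral_eq_sub_of_hasDerivAt (fun s _ => hder s)
        (hqc.intervalIntegrable _ _)]
      abel)
  have hbt := intervalIntegrable_of_integrableOn_Ioo hT hb ht
  have hKb : IntervalIntegrable (fun s => K (b s (S s (Y s)))) volume 0 t :=
    ⟨K.integrable_comp hbt.1, K.integrable_comp hbt.2⟩
  have hsum := (hxc.intervalIntegrable 0 t).add hKb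
  have e : ⟪∫ s in (0 : ℝ)..t, (S s (Y s) + K (b s (S s (Y s)))), z⟫ =
      ∫ s in (0 : ℝ)..t, ⟪S s (Y s) + K (b s (S s (Y s))), z⟫ := by
    rw [real_inner_comm, ← realInner_apply, ← (realInner X z).intervalIntegral_comp_comm hsum]
    simp only [realInner_apply, real_inner_comm]
  have e2 : ∀ s, ⟪S (-s) (b s (S s (Y s))), S (-s) (K z)⟫ + ⟪Y s, -S (-s) z⟫ =
      -⟪S s (Y s) + K (b s (S s (Y s))), z⟫ := fun s => by
    rw [hS.inner_left, neg_neg, hS.apply_neg, inner_neg_right, ← hS.inner_left, inner_add_left, hK]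
    ring
  simp only [realInner_apply, e2, neg_zero, hS.zero_apply, hY0,
    intervalIntegral.integral_neg] at key
  rw [inner_add_left, e, hK, hK, hS.inner_left]
  linarith

variable {V H : Type*} [NormedAddCommGroup V] [InnerProductSpace ℝ V] [CompleteSpace V]
  [NormedAddCommGroup H] [InnerProductSpace ℝ H] [CompleteSpace H]

/-- The inverse of the wave operator `(u, v) ↦ (v, -Λ u)` on `V × H`, where `Λ : V → V*` is the
Riesz isomorphism. As `Λ⁻¹` agrees on `H` with the adjoint `ι†` of the embedding `ι : V → H`, it is
the map `(p, q) ↦ (-ι† q, ι p)`. -/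
noncomputable def waveInverse (ι : V →L[ℝ] H) : WithLp 2 (V × H) →L[ℝ] WithLp 2 (V × H) :=
  ((WithLp.prodContinuousLinearEquiv 2 ℝ V H).symm : V × H →L[ℝ] WithLp 2 (V × H)).comp
    ((-(ι.adjoint.comp (WithLp.sndL 2 ℝ V H))).prod (ι.comp (WithLp.fstL 2 ℝ V H)))

theorem isSkew_waveInverse (ι : V →L[ℝ] H) : IsSkew (waveInverse ι) := by
  intro x y
  simp only [WithLp.prod_inner_apply]
  change ⟪-(ι.adjoint x.snd), y.fst⟫ + ⟪ι x.fst, y.snd⟫ =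
    -(⟪x.fst, -(ι.adjoint y.snd)⟫ + ⟪x.snd, ι y.fst⟫)
  rw [inner_neg_left, inner_neg_right, ContinuousLinearMap.adjoint_inner_left,
    ContinuousLinearMap.adjoint_inner_right]
  ring

theorem injective_waveInverse {ι : V →L[ℝ] H} (hinj : Function.Injective ι)
    (hd : DenseRange ι) : Function.Injective (waveInverse ι) := by
  rw [injective_iff_map_eq_zero]
  intro x hx
  have h1 : ι x.fst = 0 := congrArg WithLp.snd hx
  have h2 : ι.adjoint x.snd = 0 := neg_eq_zero.1 (congrArg WithLp.fst hx)
  have h3 : x.snd = 0 := by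
    refine hd.eq_zero_of_inner_left ℝ ?_
    intro v
    rw [← ContinuousLinearMap.adjoint_inner_left, h2, inner_zero_left]
  have h4 : x.fst = 0 := hinj (h1.trans (map_zero ι).symm)
  exact WithLp.ofLp_injective 2 (Prod.ext h4 h3)

/-- Existence for `u'' + Λ u = F(t, ι u)`, `u(0) = u₀`, `u'(0) = v₀`, with `F` Lipschitz in `H`.
The second-order equation is integrated once in time and multiplied by `Λ⁻¹`. -/
theorem exists_wave_solution {ι : V →L[ℝ] H} (hinj : Function.Injective ι) (hd : DenseRange ι)
    {T : ℝ} (hT : 0 < T) {F : ℝ → H → H} {M : ℝ} (hM : 0 ≤ M)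
    (hLip : ∀ t x y, ‖F t x - F t y‖ ≤ M * ‖x - y‖)
    (hint : ∀ w : ℝ → H, Continuous w → IntegrableOn (fun s => F s (w s)) (Ioo 0 T))
    (u₀ : V) (v₀ : H) :
    ∃ (u : ℝ → V) (v : ℝ → H), Continuous u ∧ Continuous v ∧ u 0 = u₀ ∧ v 0 = v₀ ∧
      ∀ t ∈ Icc 0 T, ι (u t) = ι u₀ + ∫ s in (0 : ℝ)..t, v s ∧
        ι.adjoint (v t) = ι.adjoint v₀ + ∫ s in (0 : ℝ)..t, (ι.adjoint (F s (ι (u s))) - u s) := by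
  let fst := WithLp.fstL 2 ℝ V H
  let snd := WithLp.sndL 2 ℝ V H
  let inr : H →L[ℝ] WithLp 2 (V × H) :=
    ((WithLp.prodContinuousLinearEquiv 2 ℝ V H).symm : V × H →L[ℝ] WithLp 2 (V × H)).comp
      (ContinuousLinearMap.inr ℝ V H)
  have hinr : ∀ q, ‖inr q‖ = ‖q‖ := fun q => WithLp.norm_toLp_snd 2 V H q
  have hfst : ∀ x : WithLp 2 (V × H), ‖fst x‖ ≤ ‖x‖ := fun x => WithLp.norm_fst_le V x
  let b : ℝ → WithLp 2 (V × H) → WithLp 2 (V × H) := fun s x => inr (F s (ι (fst x)))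
  obtain ⟨x, hxc, hx0, hx⟩ := (isSkew_waveInverse ι).exists_mild_solution
    (injective_waveInverse hinj hd) hT (b := b) (M := M * ‖ι‖) (by positivity)
    (fun t x y => by
      rw [← map_sub, hinr]
      refine (hLip _ _ _).trans ?_
      rw [← map_sub, ← map_sub, mul_assoc]
      refine mul_le_mul_of_nonneg_left ((ι.le_opNorm _).trans ?_) hM
      exact mul_le_mul_of_nonneg_left (hfst _) (norm_nonneg _))
    (fun Y hY => inr.integrable_comp (hint _ (by fun_prop)))
    (WithLp.toLp 2 (u₀, v₀))
  have hbi : IntegrableOn (fun s => F s (ι (fst (x s)))) (Ioo 0 T) := hint _ (by fun_prop)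
  refine ⟨fun t => fst (x t), fun t => snd (x t), by fun_prop, by fun_prop, ?_, ?_, ?_⟩
  · change fst (x 0) = u₀
    rw [hx0]
    rfl
  · change snd (x 0) = v₀
    rw [hx0]
    rfl
  intro t ht
  have hbt := intervalIntegrable_of_integrableOn_Ioo hT hbi ht
  have hKb : IntervalIntegrable (fun s => x s + waveInverse ι (b s (x s))) volume 0 t := by
    refine (hxc.intervalIntegrable 0 t).add ?_
    exact ⟨((waveInverse ι).comp inr).integrable_comp hbt.1,
      ((waveInverse ι).comp inr).integrable_comp hbt.2⟩
  have h1 := congrArg snd (hx t ht)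
  have h2 := congrArg fst (hx t ht)
  rw [map_add, ← snd.intervalIntegral_comp_comm hKb] at h1
  rw [map_add, ← fst.intervalIntegral_comp_comm hKb] at h2
  constructor
  · refine h1.trans ?_
    congr 1
    refine intervalIntegral.integral_congr fun s _ => ?_
    change snd (x s) + ι 0 = snd (x s)
    rw [map_zero, add_zero]
  · have h3 := congrArg (fun y => -y) h2
    simp only [neg_add, ← intervalIntegral.integral_neg] at h3
    refine (neg_neg _).symm.trans (h3.trans ?_)
    congr 1
    · exact neg_neg _
    · refine intervalIntegral.integral_congr fun s _ => ?_
      change -(fst (x s) + -(ι.adjoint (F s (ι (fst (x s)))))) = _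
      abel

/-- Uniqueness, stated for the difference of two solutions: `ι u = ∫ v` and
`Λ⁻¹ v = ∫ (Λ⁻¹ c - u)`, where `c` is the difference of the right-hand sides. With `Z₁ = ∫ u`,
`Z₂ = ∫ v = ι u` and `C = ∫ c` one has `Z₁ = Λ⁻¹ (C - v)`, hence
`(Z₁, u) + (Z₂, v) = (C - v, ι u) + (ι u, v) = (C, Z₂)`, and
`|Z₁|² + |Z₂|² = 2 ∫ (C, Z₂)`. As `|C| ≤ M ∫ |Z₂|`, Gronwall's inequality gives `Z₂ = 0`. -/
theorem wave_difference_eq_zero {ι : V →L[ℝ] H} (hinj : Function.Injective ι) {T : ℝ} (hT : 0 < T)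
    {u : ℝ → V} {v c : ℝ → H} {M : ℝ} (hM : 0 ≤ M) (hu : IntegrableOn u (Ioo 0 T))
    (hv : IntegrableOn v (Ioo 0 T)) (hc : IntegrableOn c (Ioo 0 T))
    (h1 : ∀ᵐ t ∂(timeMeasure T), ι (u t) = ∫ s in (0 : ℝ)..t, v s)
    (h2 : ∀ᵐ t ∂(timeMeasure T), ι.adjoint (v t) = ∫ s in (0 : ℝ)..t, (ι.adjoint (c s) - u s))
    (hcb : ∀ᵐ t ∂(timeMeasure T), ‖c t‖ ≤ M * ‖ι (u t)‖) :
    ∀ᵐ t ∂(timeMeasure T), u t = 0 := by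
  have iu : ∀ t ∈ Icc 0 T, IntervalIntegrable u volume 0 t := fun t =>
    intervalIntegrable_of_integrableOn_Ioo hT hu
  have iv : ∀ t ∈ Icc 0 T, IntervalIntegrable v volume 0 t := fun t =>
    intervalIntegrable_of_integrableOn_Ioo hT hv
  have ic : ∀ t ∈ Icc 0 T, IntervalIntegrable c volume 0 t := fun t =>
    intervalIntegrable_of_integrableOn_Ioo hT hc
  have hTT : T ∈ Icc 0 T := right_mem_Icc.2 hT.le
  set Z₁ : ℝ → V := fun t => ∫ s in (0 : ℝ)..t, u s with hZ₁
  set Z₂ : ℝ → H := fun t => ∫ s in (0 : ℝ)..t, v s with hZ₂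
  set C : ℝ → H := fun t => ∫ s in (0 : ℝ)..t, c s with hC
  have cZ₁ : ContinuousOn Z₁ (Icc 0 T) := by
    simpa using continuousOn_add_primitive hT.le (0 : V) (iu T hTT)
  have cZ₂ : ContinuousOn Z₂ (Icc 0 T) := by
    simpa using continuousOn_add_primitive hT.le (0 : H) (iv T hTT)
  have cC : ContinuousOn C (Icc 0 T) := by
    simpa using continuousOn_add_primitive hT.le (0 : H) (ic T hTT)
  have hae : ∀ {p : ℝ → Prop}, (∀ᵐ t ∂(timeMeasure T), p t) → ∀ t ∈ Icc 0 T,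
      ∀ᵐ s, s ∈ Ioc 0 t → p s := by
    intro p hp t ht
    rw [timeMeasure, Measure.restrict_congr_set Ioo_ae_eq_Ioc,
      ae_restrict_iff' measurableSet_Ioc] at hp
    filter_upwards [hp] with s hs hs'
    exact hs ⟨hs'.1, hs'.2.trans ht.2⟩
  have hid : ∀ᵐ t ∂(timeMeasure T), ⟪u t, Z₁ t⟫ + ⟪v t, Z₂ t⟫ = ⟪C t, Z₂ t⟫ := by
    filter_upwards [h1, h2, ae_restrict_mem measurableSet_Ioo] with t e1 e2 ht
    have ht' : t ∈ Icc 0 T := Ioo_subset_Icc_self ht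
    have iJ : IntervalIntegrable (fun s => ι.adjoint (c s)) volume 0 t :=
      ⟨ι.adjoint.integrable_comp (ic t ht').1, ι.adjoint.integrable_comp (ic t ht').2⟩
    rw [intervalIntegral.integral_sub iJ (iu t ht'),
      ι.adjoint.intervalIntegral_comp_comm (ic t ht')] at e2
    have e3 : Z₁ t = ι.adjoint (C t - v t) := by
      rw [map_sub, e2]
      simp [hZ₁, hC]
    rw [e3, ContinuousLinearMap.adjoint_inner_right, e1, inner_sub_right, real_inner_comm (C t),
      real_inner_comm (v t)]
    ring
  have henergy : ∀ t ∈ Icc 0 T, ‖Z₁ t‖ ^ 2 + ‖Z₂ t‖ ^ 2 = 2 * ∫ s in (0 : ℝ)..t, ⟪C s, Z₂ s⟫ := by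
    intro t ht
    have k1 := bilin_primitive (realInner V) ht.1 (p := u) (P := Z₁) (q := u)
      (Q := Z₁) (iu t ht) (iu t ht) (by simp [hZ₁]) (by simp [hZ₁])
    have k2 := bilin_primitive (realInner H) ht.1 (p := v) (P := Z₂) (q := v)
      (Q := Z₂) (iv t ht) (iv t ht) (by simp [hZ₂]) (by simp [hZ₂])
    have hIcc : Icc 0 t ⊆ Icc 0 T := Icc_subset_Icc_right ht.2
    have i1 := intervalIntegrable_bilin_left (realInner V) ht.1 (iu t ht)
      (cZ₁.mono hIcc)
    have i2 := intervalIntegrable_bilin_left (realInner H) ht.1 (iv t ht)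
      (cZ₂.mono hIcc)
    have z1 : Z₁ 0 = 0 := by simp [hZ₁]
    have z2 : Z₂ 0 = 0 := by simp [hZ₂]
    have s1 : ∀ s, ⟪u s, Z₁ s⟫ + ⟪Z₁ s, u s⟫ = 2 * ⟪u s, Z₁ s⟫ := fun s => by
      rw [real_inner_comm]
      ring
    have s2 : ∀ s, ⟪v s, Z₂ s⟫ + ⟪Z₂ s, v s⟫ = 2 * ⟪v s, Z₂ s⟫ := fun s => by
      rw [real_inner_comm]
      ring
    simp only [realInner_apply, z1, z2, inner_zero_left, zero_add, s1, s2,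
      real_inner_self_eq_norm_sq, intervalIntegral.integral_const_mul] at k1 k2 i1 i2
    rw [k1, k2, ← mul_add, ← intervalIntegral.integral_add i1 i2]
    congr 1
    refine intervalIntegral.integral_congr_ae ?_
    rw [uIoc_of_le ht.1]
    exact hae hid t ht
  have nZ₂ := cZ₂.norm
  have iN : ∀ t ∈ Icc 0 T, IntervalIntegrable (fun s => ‖Z₂ s‖) volume 0 t := fun t ht =>
    (nZ₂.mono (by rw [uIcc_of_le ht.1]; exact Icc_subset_Icc_right ht.2)).intervalIntegrable
  have iN2 : ∀ t ∈ Icc 0 T, IntervalIntegrable (fun s => ‖Z₂ s‖ ^ 2) volume 0 t := fun t ht =>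
    ((nZ₂.pow 2).mono
      (by rw [uIcc_of_le ht.1]; exact Icc_subset_Icc_right ht.2)).intervalIntegrable
  have hCb : ∀ t ∈ Icc 0 T, ∀ s ∈ Icc 0 t, ‖C s‖ ≤ M * ∫ r in (0 : ℝ)..t, ‖Z₂ r‖ := by
    intro t ht s hs
    have hsT : s ∈ Icc 0 T := ⟨hs.1, hs.2.trans ht.2⟩
    calc ‖C s‖ ≤ ∫ r in (0 : ℝ)..s, M * ‖Z₂ r‖ := by
          refine intervalIntegral.norm_integral_le_of_norm_le hs.1 ?_ ((iN s hsT).const_mul M)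
          filter_upwards [hae hcb s hsT, hae h1 s hsT] with r hr1 hr2 hr
          rw [hZ₂]
          simp only
          rw [← hr2 hr]
          exact hr1 hr
      _ = M * ∫ r in (0 : ℝ)..s, ‖Z₂ r‖ := intervalIntegral.integral_const_mul _ _
      _ ≤ M * ∫ r in (0 : ℝ)..t, ‖Z₂ r‖ := by
          refine mul_le_mul_of_nonneg_left ?_ hM
          exact intervalIntegral.integral_mono_interval le_rfl hs.1 hs.2
            (ae_of_all _ fun r => norm_nonneg _) (iN t ht)
  have hsq : ∀ t ∈ Icc 0 T, (∫ s in (0 : ℝ)..t, ‖Z₂ s‖) ^ 2 ≤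
      T * ∫ s in (0 : ℝ)..t, ‖Z₂ s‖ ^ 2 := by
    intro t ht
    set m := ∫ s in (0 : ℝ)..t, ‖Z₂ s‖ with hm
    set m2 := ∫ s in (0 : ℝ)..t, ‖Z₂ s‖ ^ 2 with hm2
    have h0 : 0 ≤ m2 := intervalIntegral.integral_nonneg ht.1 fun s _ => by positivity
    -- the Cauchy-Schwarz inequality, from the square of `t ‖Z₂‖ - m`
    have h3 : 0 ≤ ∫ s in (0 : ℝ)..t, (t * ‖Z₂ s‖ - m) ^ 2 :=
      intervalIntegral.integral_nonneg ht.1 fun s _ => by positivity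
    have e : (fun s => (t * ‖Z₂ s‖ - m) ^ 2) =
        fun s => t ^ 2 * ‖Z₂ s‖ ^ 2 - 2 * t * m * ‖Z₂ s‖ + m ^ 2 := by
      ext s
      ring
    rw [e, intervalIntegral.integral_add (((iN2 t ht).const_mul _).sub ((iN t ht).const_mul _))
      intervalIntegrable_const, intervalIntegral.integral_sub ((iN2 t ht).const_mul _)
      ((iN t ht).const_mul _), intervalIntegral.integral_const_mul,
      intervalIntegral.integral_const_mul, intervalIntegral.integral_const, ← hm, ← hm2] at h3
    simp only [sub_zero, smul_eq_mul] at h3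
    rcases ht.1.eq_or_lt with h4 | h4
    · rw [hm, ← h4]
      simp only [intervalIntegral.integral_same]
      nlinarith
    · have h5 : 0 ≤ t * (t * m2 - m ^ 2) := by linarith
      have h6 := nonneg_of_mul_nonneg_right h5 h4
      nlinarith [mul_le_mul_of_nonneg_right ht.2 h0]
  have hzero := eq_zero_of_le_mul_integral (C := 2 * M * T) hT
    (N := fun t => ‖Z₂ t‖ ^ 2) (nZ₂.pow 2) (fun t _ => by positivity) (fun t ht => by
      have hb : ∫ s in (0 : ℝ)..t, ⟪C s, Z₂ s⟫ ≤
          M * (∫ s in (0 : ℝ)..t, ‖Z₂ s‖) * ∫ s in (0 : ℝ)..t, ‖Z₂ s‖ := by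
        rw [← intervalIntegral.integral_const_mul]
        have hsub : uIcc 0 t ⊆ Icc 0 T := by
          rw [uIcc_of_le ht.1]
          exact Icc_subset_Icc_right ht.2
        refine intervalIntegral.integral_mono_on ht.1
          ((cC.mono hsub).inner (cZ₂.mono hsub)).intervalIntegrable ((iN t ht).const_mul _)
          fun s hs => ?_
        exact (real_inner_le_norm _ _).trans
          (mul_le_mul_of_nonneg_right (hCb t ht s hs) (norm_nonneg _))
      have he := henergy t ht
      have := mul_le_mul_of_nonneg_left (hsq t ht) hM
      nlinarith [sq_nonneg ‖Z₁ t‖])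
  filter_upwards [h1, ae_restrict_mem measurableSet_Ioo] with t e1 ht
  have h3 : Z₂ t = 0 := by
    have := hzero t (Ioo_subset_Icc_self ht)
    simpa using this
  exact hinj ((e1.trans h3).trans (map_zero ι).symm)

end Evolution

/-! ### The Sobolev spaces `H¹(I)` and `H¹₀(I)` -/

section Sobolev

open scoped RealInnerProductSpace

variable {L : EReal}

theorem isOpen_interval (L : EReal) : IsOpen (interval L) :=
  (isOpen_lt continuous_const continuous_coe_real_ereal).inter
    (isOpen_lt continuous_coe_real_ereal continuous_const)

theorem IsTestFunction.memLp {Ω : Set ℝ} {ψ : ℝ → ℝ} (h : IsTestFunction Ω ψ) :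
    MemLp ψ 2 (volume.restrict (interval L)) :=
  h.smooth.continuous.memLp_of_hasCompactSupport h.compact_support

theorem IsTestFunction.memLp_deriv {Ω : Set ℝ} {ψ : ℝ → ℝ} (h : IsTestFunction Ω ψ) :
    MemLp (deriv ψ) 2 (volume.restrict (interval L)) :=
  h.continuous_deriv.memLp_of_hasCompactSupport h.compact_support.deriv

theorem inner_toLp_eq_integral {f : ℝ → ℝ} (hf : MemLp f 2 (volume.restrict (interval L)))
    (u : H L) : ⟪hf.toLp f, u⟫ = ∫ x in interval L, f x • u x := by
  rw [L2.inner_def]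
  refine integral_congr_ae ?_
  filter_upwards [hf.coeFn_toLp] with x hx
  rw [hx]
  simp [mul_comm]

theorem eq_zero_of_forall_integral_smul_eq_zero {u : H L}
    (h : ∀ ψ, IsTestFunction (interval L) ψ → ∫ x in interval L, ψ x • u x = 0) : u = 0 := by
  have key := (isOpen_interval L).ae_eq_zero_of_integral_contDiff_smul_eq_zero
    (μ := volume.restrict (interval L)) (f := u)
    (((Lp.memLp u).locallyIntegrable (by norm_num)).locallyIntegrableOn _)
    fun ψ h1 h2 h3 => h ψ ⟨h1, h2, h3⟩
  rw [Lp.eq_zero_iff_ae_eq_zero]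
  filter_upwards [key, ae_restrict_mem (isOpen_interval L).measurableSet] with x hx hx'
  exact hx hx'

theorem isClosed_H1 (L : EReal) : IsClosed (H1 L : Set (HH L)) := by
  have e : (H1 L : Set (HH L)) = ⋂ (ψ : ℝ → ℝ) (hψ : IsTestFunction (interval L) ψ),
      {p : HH L | ⟪hψ.memLp_deriv.toLp (deriv ψ), p.fst⟫ = -⟪hψ.memLp.toLp ψ, p.snd⟫} := by
    ext p
    simp only [mem_iInter, mem_ofPred_eq, inner_toLp_eq_integral]
    rfl
  rw [e]
  refine isClosed_iInter fun ψ => isClosed_iInter fun hψ => isClosed_eq ?_ ?_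
  · exact continuous_const.inner (WithLp.fstL 2 ℝ (H L) (H L)).continuous
  · exact (continuous_const.inner (WithLp.sndL 2 ℝ (H L) (H L)).continuous).neg

/-- The pair `(ψ, ψ')` in `L²(I) × L²(I)`, for a test function `ψ`. -/
noncomputable def IsTestFunction.graph {Ω : Set ℝ} {ψ : ℝ → ℝ} (h : IsTestFunction Ω ψ) : HH L :=
  WithLp.toLp 2 (h.memLp.toLp ψ, h.memLp_deriv.toLp (deriv ψ))

theorem IsTestFunction.graph_mem_H10 {ψ : ℝ → ℝ} (h : IsTestFunction (interval L) ψ) :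
    h.graph ∈ H10 L :=
  Submodule.le_topologicalClosure _
    (Submodule.subset_span ⟨ψ, h, h.memLp.coeFn_toLp, h.memLp_deriv.coeFn_toLp⟩)

theorem H10_le_H1 (L : EReal) : H10 L ≤ H1 L := by
  refine Submodule.topologicalClosure_minimal _ (Submodule.span_le.2 ?_) (isClosed_H1 L)
  rintro p ⟨ψ, hψ, h1, h2⟩ χ hχ
  have e1 : ∫ x in interval L, deriv χ x • p.fst x = ∫ x in interval L, deriv χ x * ψ x :=
    integral_congr_ae (by filter_upwards [h1] with x hx; rw [hx, smul_eq_mul])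
  have e2 : ∫ x in interval L, χ x • p.snd x = ∫ x in interval L, χ x * deriv ψ x :=
    integral_congr_ae (by filter_upwards [h2] with x hx; rw [hx, smul_eq_mul])
  rw [e1, e2, setIntegral_eq_integral_of_forall_compl_eq_zero fun x hx => by
      rw [hψ.eq_zero hx, mul_zero],
    setIntegral_eq_integral_of_forall_compl_eq_zero fun x hx => by rw [hχ.eq_zero hx, zero_mul]]
  have hd : ∀ {θ : ℝ → ℝ}, IsTestFunction (interval L) θ → ∀ x, HasDerivAt θ (deriv θ x) x :=
    fun hθ x => (hθ.smooth.differentiable (by simp)).differentiableAt.hasDerivAt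
  have hint : ∀ {f g : ℝ → ℝ}, Continuous f → Continuous g → HasCompactSupport f →
      Integrable (f * g) := fun hf hg hs =>
    (hf.mul hg).integrable_of_hasCompactSupport hs.mul_right
  rw [integral_mul_deriv_eq_deriv_mul_of_integrable (u := χ) (v := ψ) (fun x _ => hd hχ x)
    (fun x _ => hd hψ x)
    (hint hχ.smooth.continuous hψ.continuous_deriv hχ.compact_support)
    (hint hχ.continuous_deriv hψ.smooth.continuous hχ.compact_support.deriv)
    (hint hχ.smooth.continuous hψ.smooth.continuous hχ.compact_support), neg_neg]

theorem injective_toH {V : Submodule ℝ (HH L)} (hV : V ≤ H1 L) : Function.Injective (toH V) := by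
  rw [injective_iff_map_eq_zero]
  intro v hv
  have h1 : (v : HH L).fst = 0 := hv
  have h2 : (v : HH L).snd = 0 := by
    refine eq_zero_of_forall_integral_smul_eq_zero fun ψ hψ => ?_
    have h3 : ∫ x in interval L, deriv ψ x • (v : HH L).fst x =
      -∫ x in interval L, ψ x • (v : HH L).snd x := hV v.2 ψ hψ
    rw [h1, ← inner_toLp_eq_integral hψ.memLp_deriv, inner_zero_right] at h3
    exact neg_eq_zero.1 h3.symm
  exact Subtype.ext (WithLp.ofLp_injective 2 (Prod.ext h1 h2))

theorem denseRange_toH {V : Submodule ℝ (HH L)} (hV : H10 L ≤ V) : DenseRange (toH V) := by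
  have h : Dense ((toH V : V →ₗ[ℝ] H L).range : Set (H L)) := by
    rw [Submodule.dense_iff_topologicalClosure_eq_top, Submodule.topologicalClosure_eq_top_iff,
      Submodule.eq_bot_iff]
    intro u hu
    refine eq_zero_of_forall_integral_smul_eq_zero fun ψ hψ => ?_
    rw [← inner_toLp_eq_integral hψ.memLp]
    exact (Submodule.mem_orthogonal _ _).1 hu _ ⟨⟨hψ.graph, hV hψ.graph_mem_H10⟩, rfl⟩
  exact h

end Sobolev

/-! ### The nonlinearity -/

section Force

open TopologicalSpace

/-- A map into a separable metric space is measurable if its distances to all points are. -/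
theorem measurable_of_measurable_edist {α E : Type*} [MeasurableSpace α] [PseudoEMetricSpace E]
    [SecondCountableTopology E] [MeasurableSpace E] [BorelSpace E] {f : α → E}
    (h : ∀ c, Measurable fun a => edist (f a) c) : Measurable f := by
  refine measurable_of_isOpen fun U hU => ?_
  choose r hr hrU using fun c : U => EMetric.isOpen_iff.1 hU c c.2
  obtain ⟨S, hS, hSU⟩ := isOpen_iUnion_countable (fun c : U => Metric.eball (c : E) (r c))
    fun c => Metric.isOpen_eball
  have e : U = ⋃ c ∈ S, Metric.eball (c : E) (r c) := by
    rw [hSU]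
    refine Subset.antisymm (fun x hx => mem_iUnion.2 ⟨⟨x, hx⟩, Metric.mem_eball_self (hr _)⟩) ?_
    exact iUnion_subset hrU
  rw [e, preimage_iUnion₂]
  exact MeasurableSet.biUnion hS fun c _ => measurableSet_lt (h c) measurable_const

/-- Composition of a Carathéodory function with a measurable function. -/
theorem aestronglyMeasurable_comp_of_continuous {α E G : Type*} [MeasurableSpace α] {μ : Measure α}
    [TopologicalSpace E] [MetrizableSpace E] [SecondCountableTopology E] [TopologicalSpace G]
    [PseudoMetrizableSpace G] {F : α → E → G} (hF : ∀ h, StronglyMeasurable fun t => F t h)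
    (hc : ∀ t, Continuous (F t)) {w : α → E} (hw : AEStronglyMeasurable w μ) :
    AEStronglyMeasurable (fun t => F t (w t)) μ := by
  borelize E
  have hm := stronglyMeasurable_uncurry_of_continuous_of_stronglyMeasurable
    (u := fun h t => F t h) hc hF
  refine ⟨fun t => F t (hw.mk w t), ?_, ?_⟩
  · exact hm.comp_measurable (hw.stronglyMeasurable_mk.measurable.prodMk measurable_id)
  · filter_upwards [hw.ae_eq_mk] with t ht
    rw [← ht]

variable {L : EReal} {T ε : ℝ} {φ : ℝ → ℝ → ℝ} (hφ : Measurable (Function.uncurry φ))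
  (g : Lp (H L) 2 (timeMeasure T))

theorem abs_inv_mul_sin_sub_le (ε p a b : ℝ) :
    |ε⁻¹ * (Real.sin p - Real.sin (p + ε * a)) - ε⁻¹ * (Real.sin p - Real.sin (p + ε * b))| ≤
      |a - b| := by
  have e : ε⁻¹ * (Real.sin p - Real.sin (p + ε * a)) - ε⁻¹ * (Real.sin p - Real.sin (p + ε * b)) =
      ε⁻¹ * (Real.sin (p + ε * b) - Real.sin (p + ε * a)) := by ring
  have h1 := Real.abs_sin_sub_sin_le (p + ε * b) (p + ε * a)
  have e2 : p + ε * b - (p + ε * a) = ε * (b - a) := by ring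
  rw [e2, abs_mul, abs_sub_comm b a] at h1
  rw [e, abs_mul]
  by_cases h0 : ε = 0
  · simp [h0]
  · calc |ε⁻¹| * |Real.sin (p + ε * b) - Real.sin (p + ε * a)|
        ≤ |ε⁻¹| * (|ε| * |a - b|) := by gcongr
      _ = |a - b| := by rw [← mul_assoc, ← abs_mul, inv_mul_cancel₀ h0, abs_one, one_mul]

theorem norm_force_sub_le (t : ℝ) (h k : H L) :
    ‖force T ε φ hφ g t h - force T ε φ hφ g t k‖ ≤ ‖h - k‖ := by
  have hp : Measurable fun x => φ x t := hφ.of_uncurry_right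
  rw [force, force, add_sub_add_right_eq_sub, ← MemLp.toLp_sub]
  refine Lp.norm_le_norm_of_ae_le ?_
  filter_upwards [MemLp.coeFn_toLp ((memLp_sin_sub ε hp h).sub (memLp_sin_sub ε hp k)),
    Lp.coeFn_sub h k] with x h1 h2
  rw [h1, h2]
  exact abs_inv_mul_sin_sub_le ε (φ x t) (h x) (k x)

theorem force_zero (t : ℝ) : force T ε φ hφ g t 0 = g t := by
  have hp : Measurable fun x => φ x t := hφ.of_uncurry_right
  have h0 : (memLp_sin_sub (L := L) ε hp 0).toLp _ = 0 := by
    rw [Lp.eq_zero_iff_ae_eq_zero]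
    filter_upwards [(memLp_sin_sub (L := L) ε hp 0).coeFn_toLp,
      Lp.coeFn_zero ℝ 2 (volume.restrict (interval L))] with x h1 h2
    rw [h1, h2]
    simp
  rw [force, h0, zero_add]

theorem norm_force_le (t : ℝ) (h : H L) : ‖force T ε φ hφ g t h‖ ≤ ‖h‖ + ‖g t‖ := by
  have h1 := norm_force_sub_le (ε := ε) hφ g t h 0
  rw [sub_zero, force_zero] at h1
  calc _ = ‖(force T ε φ hφ g t h - g t) + g t‖ := by rw [sub_add_cancel]
    _ ≤ _ := (norm_add_le _ _).trans (by gcongr)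

instance secondCountableTopology_H (L : EReal) : SecondCountableTopology (H L) :=
  have : Fact ((2 : ℝ≥0∞) ≠ ⊤) := ⟨by norm_num⟩
  Lp.SecondCountableTopology

theorem stronglyMeasurable_force (h : H L) :
    StronglyMeasurable fun t => force T ε φ hφ g t h := by
  refine StronglyMeasurable.add ?_ (Lp.stronglyMeasurable g)
  borelize (H L)
  refine (measurable_of_measurable_edist fun c => ?_).stronglyMeasurable
  have e : ∀ t, edist ((memLp_sin_sub ε (hφ.of_uncurry_right (y := t)) h).toLp _) c =
      (∫⁻ x in interval L, ‖ε⁻¹ * (Real.sin (φ x t) - Real.sin (φ x t + ε * h x)) - c x‖ₑ ^ (2 : ℝ))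
        ^ (1 / (2 : ℝ)) := by
    intro t
    rw [Lp.edist_def, eLpNorm_congr_ae (((memLp_sin_sub ε
      (hφ.of_uncurry_right (y := t)) h).coeFn_toLp).sub (ae_eq_refl _)),
      eLpNorm_eq_lintegral_rpow_enorm_toReal (by norm_num) (by norm_num)]
    simp
  simp only [e]
  have hφ' : Measurable fun p : ℝ × ℝ => φ p.2 p.1 := hφ.comp measurable_swap
  have hh : Measurable fun p : ℝ × ℝ => h p.2 :=
    (Lp.stronglyMeasurable h).measurable.comp measurable_snd
  have hc : Measurable fun p : ℝ × ℝ => c p.2 :=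
    (Lp.stronglyMeasurable c).measurable.comp measurable_snd
  refine Measurable.pow_const (Measurable.lintegral_prod_right' (f := fun p : ℝ × ℝ =>
    ‖ε⁻¹ * (Real.sin (φ p.2 p.1) - Real.sin (φ p.2 p.1 + ε * h p.2)) - c p.2‖ₑ ^ (2 : ℝ)) ?_) _
  fun_prop

theorem aestronglyMeasurable_force_comp {w : ℝ → H L}
    (hw : AEStronglyMeasurable w (timeMeasure T)) :
    AEStronglyMeasurable (fun t => force T ε φ hφ g t (w t)) (timeMeasure T) :=
  aestronglyMeasurable_comp_of_continuous (stronglyMeasurable_force hφ g)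
    (fun t => (LipschitzWith.of_dist_le_mul (K := 1) fun h k => by
      simpa [dist_eq_norm] using norm_force_sub_le (ε := ε) hφ g t h k).continuous) hw

theorem memLp_force_comp {w : ℝ → H L} (hw : MemLp w 2 (timeMeasure T)) :
    MemLp (fun t => force T ε φ hφ g t (w t)) 2 (timeMeasure T) :=
  (hw.norm.add (Lp.memLp g).norm).of_le (aestronglyMeasurable_force_comp hφ g hw.1)
    (ae_of_all _ fun t => (norm_force_le hφ g t (w t)).trans (le_abs_self _))

end Force

/-! ### Weak solutions and the integrated equation -/

section WeakSolution

open scoped RealInnerProductSpace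

variable {L : EReal} {V : Submodule ℝ (HH L)} {T ε : ℝ} {φ : ℝ → ℝ → ℝ}

theorem memLp_of_continuous {X : Type*} [NormedAddCommGroup X] {u : ℝ → X} (hu : Continuous u)
    (T : ℝ) : MemLp u 2 (timeMeasure T) := by
  obtain ⟨C, hC⟩ := (isCompact_Icc (a := (0 : ℝ)) (b := T)).exists_bound_of_continuousOn
    hu.continuousOn
  refine MemLp.of_bound hu.aestronglyMeasurable C ?_
  filter_upwards [ae_restrict_mem measurableSet_Ioo] with t ht
  exact hC t (Ioo_subset_Icc_self ht)

theorem integrableOn_of_memLp {X : Type*} [NormedAddCommGroup X] {u : ℝ → X}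
    (hu : MemLp u 2 (timeMeasure T)) : IntegrableOn u (Ioo 0 T) :=
  hu.integrable (by norm_num)

theorem integral_congr_timeMeasure {X : Type*} [NormedAddCommGroup X] [NormedSpace ℝ X]
    {u v : ℝ → X} (h : u =ᵐ[timeMeasure T] v) {t : ℝ} (ht : t ∈ Icc 0 T) :
    ∫ s in (0 : ℝ)..t, u s = ∫ s in (0 : ℝ)..t, v s := by
  refine intervalIntegral.integral_congr_ae ?_
  rw [uIoc_of_le ht.1]
  rw [timeMeasure, Measure.restrict_congr_set Ioo_ae_eq_Ioc] at h
  filter_upwards [(ae_restrict_iff' measurableSet_Ioc).1 h] with s hs hs'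
  exact hs ⟨hs'.1, hs'.2.trans ht.2⟩

/-- The Riesz map `Λ : V → V*` of `V`, for the inner product `(u, v)_V = (u, v) + (u_x, v_x)`. -/
noncomputable def riesz (V : Submodule ℝ (HH L)) : V →L[ℝ] StrongDual ℝ V := realInner V

theorem riesz_apply (u v : V) : riesz V u v = ⟪u, v⟫ := rfl

theorem riesz_injective : Function.Injective (riesz V) := fun _ _ h =>
  ext_inner_right ℝ fun w => congrArg (fun f : StrongDual ℝ V => f w) h

theorem norm_riesz_le (u : V) : ‖riesz V u‖ ≤ 1 * ‖u‖ := by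
  refine ContinuousLinearMap.opNorm_le_bound _ (by positivity) fun v => ?_
  rw [riesz_apply, one_mul]
  exact norm_inner_le_norm u v

theorem memLp_riesz {f : ℝ → V} (hf : MemLp f 2 (timeMeasure T)) :
    MemLp (fun t => riesz V (f t)) 2 (timeMeasure T) := by
  have h := (riesz V).continuous.comp_aestronglyMeasurable hf.1
  exact MemLp.of_le_mul (E := StrongDual ℝ V) (F := V) (c := 1) hf h
    (ae_of_all _ fun t => norm_riesz_le (f t))

variable [CompleteSpace V]

theorem integral_riesz {f : ℝ → V} {t : ℝ} (hf : IntervalIntegrable f volume 0 t) :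
    ∫ s in (0 : ℝ)..t, riesz V (f s) = riesz V (∫ s in (0 : ℝ)..t, f s) := by
  have h := ContinuousLinearMap.intervalIntegral_comp_comm (𝕜 := ℝ) (E := V)
    (F := StrongDual ℝ V) (riesz V) hf
  exact h

theorem toDual_eq_riesz_adjoint (h : H L) :
    toDual V h = riesz V ((toH V).adjoint h) := by
  ext v
  rw [riesz_apply, ContinuousLinearMap.adjoint_inner_left]
  rfl

/-- In terms of the Riesz isomorphism `Λ` of `V`, the operator `A` is `Λ - 1`. -/
theorem formOp_eq_riesz_sub (u : V) :
    formOp V u = riesz V (u - (toH V).adjoint (toH V u)) := by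
  ext v
  rw [riesz_apply, inner_sub_left, ContinuousLinearMap.adjoint_inner_left,
    Submodule.coe_inner, WithLp.prod_inner_apply]
  change ⟪(u : HH L).snd, (v : HH L).snd⟫ =
    ⟪(u : HH L).fst, (v : HH L).fst⟫ + ⟪(u : HH L).snd, (v : HH L).snd⟫ -
      ⟪(u : HH L).fst, (v : HH L).fst⟫
  ring

/-- The right-hand side of `η'' = Λ (Λ⁻¹ (f(t, η) + η) - η)`, before `Λ` is applied. -/
noncomputable def waveRhs (V : Submodule ℝ (HH L)) [CompleteSpace V] (ε : ℝ)
    (hφ : Measurable (Function.uncurry φ)) (g : Lp (H L) 2 (timeMeasure T)) (t : ℝ) (u : V) : V :=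
  (toH V).adjoint (force T ε φ hφ g t (toH V u) + toH V u) - u

variable (hφ : Measurable (Function.uncurry φ)) (g : Lp (H L) 2 (timeMeasure T))

theorem toDual_force_sub_formOp (t : ℝ) (u : V) :
    toDual V (force T ε φ hφ g t (toH V u)) - formOp V u =
      riesz V (waveRhs V ε hφ g t u) := by
  rw [toDual_eq_riesz_adjoint, formOp_eq_riesz_sub, ← map_sub, waveRhs, map_add]
  congr 1
  abel

theorem memLp_waveRhs {u : ℝ → V} (hu : MemLp u 2 (timeMeasure T)) :
    MemLp (fun t => waveRhs V ε hφ g t (u t)) 2 (timeMeasure T) := by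
  have h1 : MemLp (fun t => toH V (u t)) 2 (timeMeasure T) := (toH V).comp_memLp' hu
  exact ((toH V).adjoint.comp_memLp' ((memLp_force_comp hφ g h1).add h1)).sub hu

/-- A weak solution satisfies the equation integrated in time, with `Λ⁻¹` applied to it. -/
theorem IsWeakSolution.integrated (hT : 0 < T) {u₀ : V} {v₀ : H L} {η : Lp V 2 (timeMeasure T)}
    (h : IsWeakSolution V T ε φ hφ g u₀ v₀ η) :
    ∃ η₁ : Lp (H L) 2 (timeMeasure T),
      (∀ᵐ t ∂(timeMeasure T), toH V (η t) = toH V u₀ + ∫ s in (0 : ℝ)..t, η₁ s) ∧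
      ∀ᵐ t ∂(timeMeasure T), (toH V).adjoint (η₁ t) =
        (toH V).adjoint v₀ + ∫ s in (0 : ℝ)..t, waveRhs V ε hφ g s (η s) := by
  obtain ⟨η₁, η₂, hW, heq, hr1, hr2⟩ := h
  refine ⟨η₁, eq_primitive_of_hasWeakDeriv hT (integrableOn_of_memLp (Lp.memLp η₁))
    hW.deriv_one hr1, ?_⟩
  have h2 := eq_primitive_of_hasWeakDeriv hT (integrableOn_of_memLp (Lp.memLp η₂))
    hW.deriv_two hr2
  have h3 : η₂ =ᵐ[timeMeasure T] fun s => riesz V (waveRhs V ε hφ g s (η s)) := by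
    filter_upwards [heq] with t ht
    rw [← toDual_force_sub_formOp, ← ht, add_sub_cancel_right]
  have hi := integrableOn_of_memLp (memLp_waveRhs (ε := ε) hφ g (Lp.memLp η))
  filter_upwards [h2, ae_restrict_mem measurableSet_Ioo] with t ht htT
  have ht' := Ioo_subset_Icc_self htT
  rw [integral_congr_timeMeasure h3 ht', toDual_eq_riesz_adjoint, toDual_eq_riesz_adjoint,
    integral_riesz (intervalIntegrable_of_integrableOn_Ioo hT hi ht'),
    ← map_add] at ht
  exact riesz_injective ht

theorem IsWeakSolution.unique (hV : V ≤ H1 L) (hT : 0 < T) {u₀ : V} {v₀ : H L}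
    {η ζ : Lp V 2 (timeMeasure T)} (hη : IsWeakSolution V T ε φ hφ g u₀ v₀ η)
    (hζ : IsWeakSolution V T ε φ hφ g u₀ v₀ ζ) : η = ζ := by
  obtain ⟨η₁, a1, a2⟩ := hη.integrated hφ g hT
  obtain ⟨ζ₁, b1, b2⟩ := hζ.integrated hφ g hT
  have mH : ∀ θ : Lp V 2 (timeMeasure T), MemLp (fun t => toH V (θ t)) 2 (timeMeasure T) := fun θ =>
    (toH V).comp_memLp' (Lp.memLp θ)
  have mF : ∀ θ : Lp V 2 (timeMeasure T), MemLp
      (fun t => force T ε φ hφ g t (toH V (θ t)) + toH V (θ t)) 2 (timeMeasure T) := fun θ =>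
    (memLp_force_comp hφ g (mH θ)).add (mH θ)
  have iv : ∀ (θ : Lp (H L) 2 (timeMeasure T)) {t : ℝ}, t ∈ Icc 0 T →
      IntervalIntegrable θ volume 0 t := fun θ t ht =>
    intervalIntegrable_of_integrableOn_Ioo hT (integrableOn_of_memLp (Lp.memLp θ)) ht
  have iR : ∀ (θ : Lp V 2 (timeMeasure T)) {t : ℝ}, t ∈ Icc 0 T →
      IntervalIntegrable (fun s => waveRhs V ε hφ g s (θ s)) volume 0 t := fun θ t ht =>
    intervalIntegrable_of_integrableOn_Ioo hT
      (integrableOn_of_memLp (memLp_waveRhs hφ g (Lp.memLp θ))) ht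
  have key := wave_difference_eq_zero (injective_toH hV) hT (u := fun t => η t - ζ t)
    (v := fun t => η₁ t - ζ₁ t)
    (c := fun t => (force T ε φ hφ g t (toH V (η t)) + toH V (η t)) -
      (force T ε φ hφ g t (toH V (ζ t)) + toH V (ζ t))) (M := 2) (by norm_num)
    (integrableOn_of_memLp ((Lp.memLp η).sub (Lp.memLp ζ)))
    (integrableOn_of_memLp ((Lp.memLp η₁).sub (Lp.memLp ζ₁)))
    (integrableOn_of_memLp ((mF η).sub (mF ζ))) ?_ ?_ (ae_of_all _ fun t => ?_)
  · refine Lp.ext ?_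
    filter_upwards [key] with t ht
    exact sub_eq_zero.1 ht
  · filter_upwards [a1, b1, ae_restrict_mem measurableSet_Ioo] with t h1 h2 ht
    have ht' := Ioo_subset_Icc_self ht
    rw [map_sub, h1, h2, intervalIntegral.integral_sub (iv η₁ ht') (iv ζ₁ ht')]
    abel
  · filter_upwards [a2, b2, ae_restrict_mem measurableSet_Ioo] with t h1 h2 ht
    have ht' := Ioo_subset_Icc_self ht
    rw [map_sub, h1, h2, add_sub_add_left_eq_sub,
      ← intervalIntegral.integral_sub (iR η ht') (iR ζ ht')]
    refine intervalIntegral.integral_congr fun s _ => ?_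
    simp only [waveRhs, map_sub]
    abel
  · rw [add_sub_add_comm, map_sub]
    refine (norm_add_le _ _).trans ?_
    linarith [norm_force_sub_le (ε := ε) hφ g t (toH V (η t)) (toH V (ζ t))]

/-- A weak solution exists, with `η ∈ C([0,T];V)` and `η' ∈ C([0,T];H)`. -/
theorem exists_isWeakSolution (hV : H10 L ≤ V) (hV' : V ≤ H1 L) (hT : 0 < T) (u₀ : V) (v₀ : H L) :
    ∃ η : Lp V 2 (timeMeasure T), IsWeakSolution V T ε φ hφ g u₀ v₀ η ∧
      ∃ (η₁ : Lp (H L) 2 (timeMeasure T)) (η₂ : Lp (StrongDual ℝ V) 2 (timeMeasure T)),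
        IsInW V T η η₁ η₂ ∧ HasContinuousRep T η u₀ ∧ HasContinuousRep T η₁ v₀ := by
  obtain ⟨u, v, hu, hv, hu0, hv0, h⟩ := exists_wave_solution (injective_toH hV')
    (denseRange_toH hV) hT (F := fun t w => force T ε φ hφ g t w + w) (M := 2) (by norm_num)
    (fun t x y => by
      rw [add_sub_add_comm]
      refine (norm_add_le _ _).trans ?_
      linarith [norm_force_sub_le (ε := ε) hφ g t x y])
    (fun w hw => integrableOn_of_memLp
      ((memLp_force_comp hφ g (memLp_of_continuous hw T)).add (memLp_of_continuous hw T))) u₀ v₀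
  have mu := memLp_of_continuous hu T
  have mv := memLp_of_continuous hv T
  have mR := memLp_waveRhs (ε := ε) hφ g mu
  have mD : MemLp (fun t => riesz V (waveRhs V ε hφ g t (u t))) 2 (timeMeasure T) :=
    memLp_riesz mR
  have eu := mu.coeFn_toLp
  have ev := mv.coeFn_toLp
  have eD : mD.toLp _ =ᵐ[timeMeasure T] fun t => riesz V (waveRhs V ε hφ g t (u t)) :=
    MemLp.coeFn_toLp (E := StrongDual ℝ V) mD
  have hW : IsInW V T (mu.toLp u) (mv.toLp v) (mD.toLp _) := by
    constructor
    · refine hasWeakDeriv_of_eq_primitive hT (integrableOn_of_memLp (Lp.memLp _))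
        (c := toH V u₀) ?_
      filter_upwards [eu, ae_restrict_mem measurableSet_Ioo] with t h1 ht
      have ht' := Ioo_subset_Icc_self ht
      rw [h1, integral_congr_timeMeasure ev ht']
      exact (h t ht').1
    · refine hasWeakDeriv_of_eq_primitive hT (integrableOn_of_memLp (Lp.memLp _))
        (c := toDual V v₀) ?_
      filter_upwards [ev, ae_restrict_mem measurableSet_Ioo] with t h1 ht
      have ht' := Ioo_subset_Icc_self ht
      rw [h1, integral_congr_timeMeasure eD ht', toDual_eq_riesz_adjoint,
        toDual_eq_riesz_adjoint, integral_riesz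
          (intervalIntegrable_of_integrableOn_Ioo hT (integrableOn_of_memLp mR) ht'), ← map_add]
      exact congrArg _ (h t ht').2
  refine ⟨mu.toLp u, ⟨mv.toLp v, mD.toLp _, hW, ?_, ?_, ?_⟩, mv.toLp v, mD.toLp _, hW,
    ⟨u, hu.continuousOn, eu.symm, hu0⟩, ⟨v, hv.continuousOn, ev.symm, hv0⟩⟩
  · filter_upwards [eu, eD] with t h1 h2
    rw [h1, h2, ← toDual_force_sub_formOp, sub_add_cancel]
  · refine ⟨fun t => toH V (u t), ((toH V).continuous.comp hu).continuousOn, ?_, congrArg _ hu0⟩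
    filter_upwards [eu] with t h1
    rw [h1]
  · refine ⟨fun t => toDual V (v t), ?_, ?_, congrArg _ hv0⟩
    · simp only [toDual_eq_riesz_adjoint]
      exact ((riesz V).continuous.comp ((toH V).adjoint.continuous.comp hv)).continuousOn
    · filter_upwards [ev] with t h1
      rw [h1]

end WeakSolution

end SineGordon

theorem theorem1 (L : EReal) (hL : 0 < L)
    (V : Submodule ℝ (SineGordon.HH L)) (hV : V = SineGordon.H10 L ∨ V = SineGordon.H1 L)
    (T : ℝ) (hT : 0 < T) (ε : ℝ) (hε₀ : 0 < ε) (hε₁ : ε ≤ 1)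
    (φ : ℝ → ℝ → ℝ) (hφ : Measurable (Function.uncurry φ))
    (g : Lp (SineGordon.H L) 2 (SineGordon.timeMeasure T)) (u₀ : V) (v₀ : SineGordon.H L) :
    (∃! η : Lp V 2 (SineGordon.timeMeasure T),
      SineGordon.IsWeakSolution V T ε φ hφ g u₀ v₀ η) ∧
    (∀ η : Lp V 2 (SineGordon.timeMeasure T),
      SineGordon.IsWeakSolution V T ε φ hφ g u₀ v₀ η →
      ∃ (η₁ : Lp (SineGordon.H L) 2 (SineGordon.timeMeasure T))
        (η₂ : Lp (StrongDual ℝ V) 2 (SineGordon.timeMeasure T)),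
        SineGordon.IsInW V T η η₁ η₂ ∧
        SineGordon.HasContinuousRep T η u₀ ∧
        SineGordon.HasContinuousRep T η₁ v₀) := by
  have hle : SineGordon.H10 L ≤ V := by
    rcases hV with rfl | rfl
    · exact le_rfl
    · exact SineGordon.H10_le_H1 L
  have hle' : V ≤ SineGordon.H1 L := by
    rcases hV with rfl | rfl
    · exact SineGordon.H10_le_H1 L
    · exact le_rfl
  have hclosed : IsClosed (V : Set (SineGordon.HH L)) := by
    rcases hV with rfl | rfl
    · exact Submodule.isClosed_topologicalClosure _
    · exact SineGordon.isClosed_H1 L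
  have : CompleteSpace V := hclosed.completeSpace_coe
  obtain ⟨ζ, hζ, hreg⟩ := SineGordon.exists_isWeakSolution (ε := ε) hφ g hle hle' hT u₀ v₀
  refine ⟨⟨ζ, hζ, fun η hη => hη.unique hφ g hle' hT hζ⟩, fun η hη => ?_⟩
  rw [hη.unique hφ g hle' hT hζ]
  exact hreg
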